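/- Let $n\ge 2$ and let $\Omega\subset\mathbb{R}^n$ be a bounded domain (nonempty, open, connected) with $C^1$ boundary $\partial\Omega$, with unit outer normal $\nu$ and surface measure $dS$ on $\partial\Omega$. Let $u\in C^4(\overline\Omega)$ (all derivatives up to order four extend continuously to $\overline\Omega$) be a solution of $$\Delta^2u=1\ \text{ in }\Omega,\qquad u=\frac{\partial u}{\partial\nu}=0\ \text{ on }\partial\Omega,$$ and set $v:=-\Delta u$. Then, for every $z\in\Omega$ and every $c\in\mathbb{R}$, both integrals below exist (their integrands are integrable) and $$\int_\Omega u\left\{|D^2v|^2-\frac{(\Delta v)^2}{n}\right\}dx=\frac14\int_{\partial\Omega}\left\{c^2-(\Delta u)^2\right\}\left\{\frac{\partial v}{\partial\nu}+\frac{(x-z)\cdot\nu}{n}\right\}dS,$$ where $|D^2v|^2=\sum_{i,j=1}^n(\partial_{ij}v)^2$. -/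

import Mathlib

open MeasureTheory InnerProductSpace
open scoped Laplacian

section Boundary

variable {E : Type*} [NormedAddCommGroup E] [InnerProductSpace ℝ E] [FiniteDimensional ℝ E]

/-- Inside the ball `B(x, r)`, the set `Ω` is the part of the ball lying strictly above the graph of
the `C¹` function `γ`, which is defined on the hyperplane orthogonal to the unit vector `e`
(the "upward" direction). -/
structure IsC1BoundaryGraph (Ω : Set E) (x e : E) (r : ℝ) (γ : (ℝ ∙ e)ᗮ → ℝ) : Prop where
  norm_direction : ‖e‖ = 1
  radius_pos : 0 < r
  contDiff : ContDiff ℝ 1 γ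
  mem_iff : ∀ y ∈ Metric.ball x r,
    y ∈ Ω ↔ γ ((ℝ ∙ e)ᗮ.orthogonalProjectionOnto y) < inner ℝ e y

/-- A domain (connected, nonempty, open set) with `C¹` boundary: near each boundary point it is, after
a rotation of the axes, the region strictly above the graph of a `C¹` function. -/
structure IsC1Domain (Ω : Set E) : Prop where
  isOpen : IsOpen Ω
  isConnected : IsConnected Ω
  boundary : ∀ x ∈ frontier Ω, ∃ (e : E) (r : ℝ) (γ : (ℝ ∙ e)ᗮ → ℝ), IsC1BoundaryGraph Ω x e r γ

/-- `w` is the unit outer normal vector to `∂Ω` at the boundary point `x`: if `Ω` is the region above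
the graph of `γ` near `x`, then `w = (∇γ - e) / √(1 + |∇γ|²)`, with `∇γ` taken at the projection
of `x`. -/
def IsUnitOuterNormal (Ω : Set E) (x w : E) : Prop :=
  x ∈ frontier Ω ∧ ∃ (e : E) (r : ℝ) (γ : (ℝ ∙ e)ᗮ → ℝ), IsC1BoundaryGraph Ω x e r γ ∧
    w = (√(1 + ‖gradient γ ((ℝ ∙ e)ᗮ.orthogonalProjectionOnto x)‖ ^ 2))⁻¹ •
      (((gradient γ ((ℝ ∙ e)ᗮ.orthogonalProjectionOnto x) : (ℝ ∙ e)ᗮ) : E) - e)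

end Boundary

/-- The squared Euclidean norm `|D²f|² = ∑ᵢⱼ (∂ᵢⱼ f)²` of the Hessian matrix of `f` at `x`, where
derivatives are taken within the set `s`. -/
noncomputable def hessianNormSqWithin {n : ℕ} (f : EuclideanSpace ℝ (Fin n) → ℝ)
    (s : Set (EuclideanSpace ℝ (Fin n))) (x : EuclideanSpace ℝ (Fin n)) : ℝ :=
  ∑ i : Fin n, ∑ j : Fin n,
    (iteratedFDerivWithin ℝ 2 f s x
      ![EuclideanSpace.single i (1 : ℝ), EuclideanSpace.single j (1 : ℝ)]) ^ 2

/-- `u ∈ C⁴(Ω̄)` is a classical solution of the Dirichlet problem `Δ²u = 1` in `Ω`,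
`u = ∂u/∂ν = 0` on `∂Ω`. Derivatives are taken within `Ω̄`: in `Ω` these are the usual derivatives, and
on `∂Ω` they are their continuous extensions. -/
structure IsBiharmonicDirichletSolution {n : ℕ} (Ω : Set (EuclideanSpace ℝ (Fin n)))
    (ν : EuclideanSpace ℝ (Fin n) → EuclideanSpace ℝ (Fin n))
    (u : EuclideanSpace ℝ (Fin n) → ℝ) : Prop where
  contDiffOn : ContDiffOn ℝ 4 u (closure Ω)
  equation : ∀ x ∈ Ω, laplacianWithin (laplacianWithin u (closure Ω)) (closure Ω) x = 1
  boundary_value : ∀ x ∈ frontier Ω, u x = 0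
  normal_derivative : ∀ x ∈ frontier Ω, fderivWithin ℝ u (closure Ω) x (ν x) = 0

/-! Set h = v + |x - z|²/(2n) and p = ∇h. Since Δv = -1, h is harmonic, and D²h = D²v + I/n is the
trace-free part of D²v, so the left integrand is u|Dp|². Formally, Bochner's identity |Dp|² =
Δ(|p|²/2) and the vanishing Cauchy data of u give ∫ u|Dp|² = -½ ∫ v|p|². On the other side, the
divergence of (c² - v²)p is -2v ∇v·p = -2v|p|² + (2/n) v (x - z)·p. The last term integrates to
zero: (x - z)·∇h is harmonic, hence orthogonal to v = -Δu. Thus the flux of (c² - v²)p through ∂Ω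
equals -2 ∫ v|p|² = 4 ∫ u|Dp|², and on ∂Ω the factor p·ν is ∂v/∂ν + (x - z)·ν/n.

The regularity of u gives v only two derivatives up to the boundary, so p is only C¹ there and
Bochner's identity cannot be integrated directly. Its weak form is used instead: each ∂ⱼp is weakly
divergence-free (`setIntegral_sum_fderiv_mul_fderiv_eq_zero`), and admissible test functions include
all C¹ functions on the closure vanishing on ∂Ω
(`IsC1Domain.setIntegral_sum_mul_fderivWithin_eq_zero`). Testing with u pⱼ and (xⱼ - zⱼ)u and
summing over j yields `integral_mul_sum_sq` and `integral_radial_mul`; `integral_identity` combines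
them.

The other pillar is the divergence theorem on bounded C¹ domains with Hausdorff surface measure,
`IsC1Domain.satisfiesDivergenceThm`. It follows from an area formula for C¹ immersions, applied to
graphs, from Fubini and the fundamental theorem of calculus above a graph, and from a partition of
unity. -/

/-! ### Area formula for injective C¹ immersions -/

section AreaFormula

open Filter Topology Set
open scoped NNReal ENNReal

/-- A locally valid inequality between measures holds globally. -/
theorem MeasureTheory.Measure.le_of_forall_exists_nhds {X : Type*} [TopologicalSpace X]
    [SecondCountableTopology X] [MeasurableSpace X] [OpensMeasurableSpace X] {μ ν : Measure X}
    (h : ∀ x, ∃ U ∈ 𝓝 x, ∀ A ⊆ U, MeasurableSet A → μ A ≤ ν A) : μ ≤ ν := by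
  choose U hU hUA using h
  rw [Measure.le_iff]
  intro A hA
  have hU' : ∀ x, interior (U x) ∈ 𝓝 x := fun x => interior_mem_nhds.2 (hU x)
  obtain ⟨s, hs, hsU⟩ := TopologicalSpace.countable_cover_nhds hU'
  rcases isEmpty_or_nonempty X with hX | hX
  · simp [Set.eq_empty_of_isEmpty A]
  have hne : s.Nonempty := by
    by_contra hne
    rw [Set.not_nonempty_iff_eq_empty] at hne
    subst hne
    simp only [mem_empty_iff_false, iUnion_of_empty, iUnion_empty] at hsU
    exact empty_ne_univ hsU
  obtain ⟨φ, rfl⟩ := hs.exists_eq_range hne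
  have hcov : ⋃ n, interior (U (φ n)) = univ := by simpa using hsU
  let B : ℕ → Set X := disjointed fun n => interior (U (φ n))
  have hBm : ∀ n, MeasurableSet (B n) := fun n =>
    MeasurableSet.disjointed (fun i => isOpen_interior.measurableSet) n
  have hBu : ⋃ n, B n = univ := by rw [iUnion_disjointed, hcov]
  have hdis : Pairwise (Function.onFun Disjoint fun n => A ∩ B n) := fun i j hij =>
    ((disjoint_disjointed (fun n => interior (U (φ n)))) hij).mono inter_subset_right
      inter_subset_right
  have hA' : A = ⋃ n, A ∩ B n := by rw [← inter_iUnion, hBu, inter_univ]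
  rw [hA', measure_iUnion hdis fun n => hA.inter (hBm n),
    measure_iUnion hdis fun n => hA.inter (hBm n)]
  refine ENNReal.tsum_le_tsum fun n => hUA (φ n) _ ?_ (hA.inter (hBm n))
  exact inter_subset_right.trans ((disjointed_subset _ n).trans interior_subset)

/-- The correspondence g x ↦ f x is well defined on the image of A, since f x = f y whenever g x = g
y, and it is K-Lipschitz there. It is realized as f composed with a chosen right inverse of g. -/
theorem euclideanHausdorffMeasure_image_le_of_edist_le {α X Y : Type*} [EMetricSpace X]
    [MeasurableSpace X] [BorelSpace X] [EMetricSpace Y] [MeasurableSpace Y] [BorelSpace Y]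
    {f : α → X} {g : α → Y} {A : Set α} {K : ℝ≥0}
    (h : ∀ x ∈ A, ∀ y ∈ A, edist (f x) (f y) ≤ K * edist (g x) (g y)) (d : ℕ) :
    μHE[d] (f '' A) ≤ (K : ℝ≥0∞) ^ d * μHE[d] (g '' A) := by
  rcases A.eq_empty_or_nonempty with rfl | ⟨a, ha⟩
  · simp
  have : Nonempty α := ⟨a⟩
  let i : Y → α := Function.invFunOn g A
  have hi : ∀ x ∈ A, i (g x) ∈ A ∧ g (i (g x)) = g x := fun x hx =>
    ⟨Function.invFunOn_mem ⟨x, hx, rfl⟩, Function.invFunOn_eq ⟨x, hx, rfl⟩⟩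
  have hL : LipschitzOnWith K (f ∘ i) (g '' A) := by
    rintro _ ⟨x, hx, rfl⟩ _ ⟨y, hy, rfl⟩
    have := h _ (hi x hx).1 _ (hi y hy).1
    rwa [(hi x hx).2, (hi y hy).2] at this
  have him : (f ∘ i) '' (g '' A) = f '' A := by
    rw [image_image]
    refine image_congr fun x hx => ?_
    have := h _ (hi x hx).1 _ hx
    rw [(hi x hx).2, edist_self, mul_zero] at this
    exact edist_eq_zero.1 (le_antisymm this (zero_le))
  have key := hL.hausdorffMeasure_image_le (d := d) (by positivity)
  rw [him, ENNReal.rpow_natCast] at key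
  simp only [Measure.euclideanHausdorffMeasure_def, Measure.smul_apply, ENNReal.smul_def,
    smul_eq_mul]
  calc _ ≤ _ := mul_le_mul_right key _
    _ = _ := by ring

variable {U V : Type*} [NormedAddCommGroup U] [InnerProductSpace ℝ U] [FiniteDimensional ℝ U]
  [NormedAddCommGroup V] [InnerProductSpace ℝ V]

/-- An injective linear map in finite dimension is bounded below, so the strict-derivative remainder
o(‖x - y‖) is an arbitrarily small fraction of ‖L x - L y‖. -/
theorem HasStrictFDerivAt.exists_nhds_norm_sub_le {G : U → V} {L : U →L[ℝ] V} {y₀ : U}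
    (hG : HasStrictFDerivAt G L y₀) (hL : Function.Injective L) {K : ℝ} (hK : 1 < K) :
    ∃ N ∈ 𝓝 y₀, ∀ x ∈ N, ∀ y ∈ N,
      ‖G x - G y‖ ≤ K * ‖L x - L y‖ ∧ ‖L x - L y‖ ≤ K * ‖G x - G y‖ := by
  obtain ⟨c, hc, hcL⟩ := (LinearMap.injective_iff_antilipschitz (f := L.toLinearMap)).1 hL
  have hc' : (0 : ℝ) < c := hc
  have hlow : ∀ h : U, ‖h‖ ≤ c * ‖L h‖ := fun h => by
    have := hcL.le_mul_dist h 0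
    simpa using this
  -- Chosen so that the remainder is at most (1 - K⁻¹)‖L x - L y‖. This gives the lower bound with
  -- factor K⁻¹ exactly, and the upper bound because 2 - K⁻¹ ≤ K.
  let δ : ℝ := (1 - K⁻¹) / c
  have hK0 : 0 < K := by linarith
  have hK1 : 0 < 1 - K⁻¹ := by
    have := inv_lt_one_of_one_lt₀ hK
    linarith
  have hδ : 0 < δ := by positivity
  have hloc := hG.isLittleO.bound hδ
  rw [nhds_prod_eq] at hloc
  obtain ⟨N, hN, hNs⟩ := (eventually_prod_self_iff
    (r := fun x y => ‖G x - G y - L (x - y)‖ ≤ δ * ‖x - y‖)).1 hloc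
  refine ⟨N, hN, fun x hx y hy => ?_⟩
  have h1 := hNs x hx y hy
  simp only [map_sub] at h1
  have h2 := hlow (x - y)
  simp only [map_sub] at h2
  have h3 : ‖G x - G y - (L x - L y)‖ ≤ (1 - K⁻¹) * ‖L x - L y‖ := by
    refine h1.trans ?_
    calc δ * ‖x - y‖ ≤ δ * (c * ‖L x - L y‖) := by gcongr
      _ = _ := by simp only [δ]; field_simp
  have h4 : ‖G x - G y‖ ≤ ‖L x - L y‖ + ‖G x - G y - (L x - L y)‖ := by
    have := norm_add_le (L x - L y) (G x - G y - (L x - L y))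
    simpa using this
  have h5 : ‖L x - L y‖ ≤ ‖G x - G y‖ + ‖G x - G y - (L x - L y)‖ := by
    have := norm_sub_le (G x - G y) (G x - G y - (L x - L y))
    simpa using this
  have h6 : 1 - K⁻¹ ≤ K - 1 := by
    have : K * K⁻¹ = 1 := mul_inv_cancel₀ hK0.ne'
    nlinarith [inv_pos.2 hK0]
  constructor
  · nlinarith [norm_nonneg (L x - L y)]
  · have h7 : K⁻¹ * ‖L x - L y‖ ≤ ‖G x - G y‖ := by linarith
    calc _ = K * (K⁻¹ * ‖L x - L y‖) := by field_simp
      _ ≤ _ := by gcongr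

theorem ContinuousLinearMap.continuous_normDet [CompleteSpace V] :
    Continuous fun L : U →L[ℝ] V => L.toLinearMap.normDet := by
  have h : ∀ L : U →L[ℝ] V, L.toLinearMap.normDet =
      √((ContinuousLinearMap.adjoint L ∘L L).det) := fun L => by
    have : L.toLinearMap.normDet ^ 2 = (ContinuousLinearMap.adjoint L ∘L L).det := by
      simpa using L.normDet_sq
    rw [← this, Real.sqrt_sq (LinearMap.normDet_nonneg _)]
  simp_rw [h]
  refine Real.continuous_sqrt.comp (ContinuousLinearMap.continuous_det.comp ?_)
  have : Continuous fun L : U →L[ℝ] V => ContinuousLinearMap.adjoint L :=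
    (ContinuousLinearMap.adjoint (𝕜 := ℝ) (E := U) (F := V)).continuous
  exact this.clm_comp continuous_id

variable [MeasurableSpace U] [BorelSpace U] [MeasurableSpace V] [BorelSpace V]

/-- **Area formula** for an injective immersion of class `C¹`. -/
theorem euclideanHausdorffMeasure_image_eq_lintegral [CompleteSpace V] {G : U → V}
    (hG : ContDiff ℝ 1 G) (hinj : Function.Injective G)
    (himm : ∀ y, Function.Injective (fderiv ℝ G y)) :
    (volume.withDensity fun y => ENNReal.ofReal (fderiv ℝ G y).toLinearMap.normDet).map G =
      (μHE[Module.finrank ℝ U]).restrict (range G) := by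
  set d := Module.finrank ℝ U
  set J : U → ℝ := fun y => (fderiv ℝ G y).toLinearMap.normDet with hJ
  have hJc : Continuous J :=
    ContinuousLinearMap.continuous_normDet.comp (hG.continuous_fderiv one_ne_zero)
  have hJpos : ∀ y, 0 < J y := fun y => lt_of_le_of_ne (LinearMap.normDet_nonneg _)
    (Ne.symm (((LinearMap.normDet_ne_zero_tfae _).out 0 4).2 (himm y)))
  have hemb : MeasurableEmbedding G := hG.continuous.measurableEmbedding hinj
  have hcomap : ∀ A, Measure.comap G (μHE[d]) A = μHE[d] (G '' A) := fun A => hemb.comap_apply _ _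
  have hdens : ∀ A, MeasurableSet A → (volume.withDensity fun y => ENNReal.ofReal (J y)) A =
      ∫⁻ y in A, ENNReal.ofReal (J y) := fun A hA => withDensity_apply _ hA
  -- Near y₀ the map is compared with its derivative at y₀, for which the area formula is linear
  -- algebra. In the exponent d + 1, K ^ d comes from the bi-Lipschitz comparison and one more K
  -- from the oscillation of the Jacobian.
  have hlocal : ∀ K : ℝ, 1 < K → ∀ y₀, ∃ N ∈ 𝓝 y₀, ∀ A ⊆ N, MeasurableSet A →
      Measure.comap G (μHE[d]) A ≤
        (ENNReal.ofReal (K ^ (d + 1)) • volume.withDensity fun y => ENNReal.ofReal (J y)) A ∧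
      (volume.withDensity fun y => ENNReal.ofReal (J y)) A ≤
        (ENNReal.ofReal (K ^ (d + 1)) • Measure.comap G (μHE[d])) A := by
    intro K hK y₀
    have hK0 : 0 < K := by linarith
    obtain ⟨N, hN, hNK⟩ := (hG.contDiffAt.hasStrictFDerivAt one_ne_zero
      (x := y₀)).exists_nhds_norm_sub_le (himm y₀) hK
    have hJ1 : ∀ᶠ y in 𝓝 y₀, J y₀ < K * J y :=
      (continuous_const.mul hJc).continuousAt.eventually (lt_mem_nhds
        (by change J y₀ < K * J y₀; nlinarith [hJpos y₀]))
    have hJ2 : ∀ᶠ y in 𝓝 y₀, J y < K * J y₀ :=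
      hJc.continuousAt.eventually (gt_mem_nhds (by nlinarith [hJpos y₀]))
    refine ⟨N ∩ {y | J y₀ < K * J y ∧ J y < K * J y₀}, inter_mem hN (hJ1.and hJ2),
      fun A hA hAm => ?_⟩
    have hKN : ((K.toNNReal : ℝ≥0) : ℝ≥0∞) = ENNReal.ofReal K := rfl
    have hvol := (fderiv ℝ G y₀).toLinearMap.euclideanHausdorffMeasure_image_eq_normDet_mul_volume A
    have e1 := euclideanHausdorffMeasure_image_le_of_edist_le (f := G) (g := fderiv ℝ G y₀) (A := A)
      (K := K.toNNReal) (fun x hx y hy => by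
        rw [edist_dist, edist_dist, hKN, ← ENNReal.ofReal_mul hK0.le, dist_eq_norm, dist_eq_norm]
        exact ENNReal.ofReal_le_ofReal (hNK x (hA hx).1 y (hA hy).1).1) d
    have e2 := euclideanHausdorffMeasure_image_le_of_edist_le (f := fderiv ℝ G y₀) (g := G) (A := A)
      (K := K.toNNReal) (fun x hx y hy => by
        rw [edist_dist, edist_dist, hKN, ← ENNReal.ofReal_mul hK0.le, dist_eq_norm, dist_eq_norm]
        exact ENNReal.ofReal_le_ofReal (hNK x (hA hx).1 y (hA hy).1).2) d
    rw [hKN, ← ENNReal.ofReal_pow hK0.le] at e1 e2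
    change μHE[d] (fderiv ℝ G y₀ '' A) = ENNReal.ofReal (J y₀) * volume A at hvol
    rw [hvol] at e1 e2
    have i1 : ENNReal.ofReal (J y₀) * volume A ≤
        ENNReal.ofReal K * ∫⁻ y in A, ENNReal.ofReal (J y) := by
      rw [← lintegral_const_mul _ (by fun_prop), ← setLIntegral_const]
      refine setLIntegral_mono (by fun_prop) fun y hy => ?_
      rw [← ENNReal.ofReal_mul hK0.le]
      exact ENNReal.ofReal_le_ofReal (hA hy).2.1.le
    have i2 : ∫⁻ y in A, ENNReal.ofReal (J y) ≤
        ENNReal.ofReal K * (ENNReal.ofReal (J y₀) * volume A) := by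
      rw [← setLIntegral_const, ← lintegral_const_mul _ (by fun_prop)]
      refine setLIntegral_mono (by fun_prop) fun y hy => ?_
      rw [← ENNReal.ofReal_mul hK0.le]
      exact ENNReal.ofReal_le_ofReal (hA hy).2.2.le
    have hp : ENNReal.ofReal (K ^ (d + 1)) = ENNReal.ofReal (K ^ d) * ENNReal.ofReal K := by
      rw [pow_succ, ENNReal.ofReal_mul (by positivity)]
    simp only [Measure.smul_apply, smul_eq_mul, hcomap, hdens A hAm, hp]
    constructor
    · calc _ ≤ _ := e1
        _ ≤ ENNReal.ofReal (K ^ d) * (ENNReal.ofReal K * ∫⁻ y in A, ENNReal.ofReal (J y)) := by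
          gcongr
        _ = _ := by rw [mul_assoc]
    · calc _ ≤ _ := i2
        _ ≤ ENNReal.ofReal K * (ENNReal.ofReal (K ^ d) * μHE[d] (G '' A)) := by gcongr
        _ = _ := by ring
  have hlim : ∀ a b : ℝ≥0∞, (∀ K : ℝ, 1 < K → a ≤ ENNReal.ofReal (K ^ (d + 1)) * b) → a ≤ b := by
    intro a b hab
    have ht : Tendsto (fun K : ℝ => ENNReal.ofReal (K ^ (d + 1)) * b) (𝓝[>] 1) (𝓝 (1 * b)) := by
      refine ENNReal.Tendsto.mul_const ?_ (Or.inl one_ne_zero)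
      have : Tendsto (fun K : ℝ => ENNReal.ofReal (K ^ (d + 1))) (𝓝 1)
          (𝓝 (ENNReal.ofReal (1 ^ (d + 1)))) := by
        refine (ENNReal.continuous_ofReal.comp (continuous_pow _)).tendsto 1
      rw [one_pow, ENNReal.ofReal_one] at this
      exact this.mono_left nhdsWithin_le_nhds
    rw [one_mul] at ht
    exact ge_of_tendsto ht (eventually_mem_nhdsWithin.mono fun K hK => hab K hK)
  -- The local inequalities globalize for each fixed K > 1, and then K tends to 1.
  have heq : volume.withDensity (fun y => ENNReal.ofReal (J y)) = Measure.comap G (μHE[d]) := by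
    refine le_antisymm ?_ ?_
    · refine Measure.le_iff.2 fun A _ => hlim _ _ fun K hK => ?_
      have := Measure.le_of_forall_exists_nhds (μ := volume.withDensity fun y => ENNReal.ofReal (J y))
        (ν := ENNReal.ofReal (K ^ (d + 1)) • Measure.comap G (μHE[d])) fun y₀ => by
          obtain ⟨N, hN, h⟩ := hlocal K hK y₀
          exact ⟨N, hN, fun A hA hAm => (h A hA hAm).2⟩
      exact this A
    · refine Measure.le_iff.2 fun A _ => hlim _ _ fun K hK => ?_
      have := Measure.le_of_forall_exists_nhds (μ := Measure.comap G (μHE[d]))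
        (ν := ENNReal.ofReal (K ^ (d + 1)) • volume.withDensity fun y => ENNReal.ofReal (J y))
        fun y₀ => by
          obtain ⟨N, hN, h⟩ := hlocal K hK y₀
          exact ⟨N, hN, fun A hA hAm => (h A hA hAm).1⟩
      exact this A
  rw [heq, hemb.map_comap]

end AreaFormula

/-! ### Graph coordinates and surface measure on a graph -/

section Graph

open Filter Topology Set
open scoped NNReal ENNReal

variable {E : Type*} [NormedAddCommGroup E] [InnerProductSpace ℝ E]

/-- The parametrization `y ↦ y + γ(y) e` of the graph of `γ`. -/
noncomputable def graphMap (e : E) (γ : (ℝ ∙ e)ᗮ → ℝ) (y : (ℝ ∙ e)ᗮ) : E := (y : E) + γ y • e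

/-- The coordinates `(y, t) ↦ y + (γ(y) + t) e` around the graph of `γ`. -/
noncomputable def graphChart (e : E) (γ : (ℝ ∙ e)ᗮ → ℝ) (p : (ℝ ∙ e)ᗮ × ℝ) : E :=
  (p.1 : E) + (γ p.1 + p.2) • e

theorem graphChart_zero (e : E) (γ : (ℝ ∙ e)ᗮ → ℝ) (y : (ℝ ∙ e)ᗮ) :
    graphChart e γ (y, 0) = graphMap e γ y := by
  simp [graphChart, graphMap]

theorem inner_coe_orthogonal_span_singleton (e : E) (y : (ℝ ∙ e)ᗮ) : inner ℝ e (y : E) = 0 :=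
  Submodule.mem_orthogonal_singleton_iff_inner_right.1 y.2

theorem orthogonalProjectionOnto_add_smul [FiniteDimensional ℝ E] (e : E) (y : (ℝ ∙ e)ᗮ) (t : ℝ) :
    (ℝ ∙ e)ᗮ.orthogonalProjectionOnto ((y : E) + t • e) = y := by
  have h : (ℝ ∙ e)ᗮ.orthogonalProjectionOnto e = 0 := by
    rw [Submodule.orthogonalProjectionOnto_eq_zero_iff]
    simp
  simp [h]

theorem inner_add_smul {e : E} (he : ‖e‖ = 1) (y : (ℝ ∙ e)ᗮ) (t : ℝ) :
    inner ℝ e ((y : E) + t • e) = t := by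
  simp [inner_add_right, inner_smul_right, inner_coe_orthogonal_span_singleton, he]

theorem orthogonalProjectionOnto_add_inner_smul [FiniteDimensional ℝ E] {e : E} (he : ‖e‖ = 1)
    (x : E) : ((ℝ ∙ e)ᗮ.orthogonalProjectionOnto x : E) + inner ℝ e x • e = x := by
  have h := (ℝ ∙ e).starProjection_add_starProjection_orthogonal x
  rw [Submodule.starProjection_unit_singleton ℝ he] at h
  rw [add_comm]
  exact h

theorem graphChart_injective [FiniteDimensional ℝ E] {e : E} (he : ‖e‖ = 1) (γ : (ℝ ∙ e)ᗮ → ℝ) :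
    Function.Injective (graphChart e γ) := by
  rintro ⟨y, t⟩ ⟨y', t'⟩ h
  have h1 := congrArg (ℝ ∙ e)ᗮ.orthogonalProjectionOnto h
  have h2 := congrArg (fun x => inner ℝ e x) h
  simp only [graphChart, orthogonalProjectionOnto_add_smul, inner_add_smul he] at h1 h2
  subst h1
  simp only [add_right_inj] at h2
  rw [h2]

theorem graphMap_injective [FiniteDimensional ℝ E] {e : E} (he : ‖e‖ = 1) (γ : (ℝ ∙ e)ᗮ → ℝ) :
    Function.Injective (graphMap e γ) := fun y y' h => by
  have : graphChart e γ (y, 0) = graphChart e γ (y', 0) := by simpa [graphChart_zero] using h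
  exact congrArg Prod.fst (graphChart_injective he γ this)

theorem continuous_graphMap {e : E} {γ : (ℝ ∙ e)ᗮ → ℝ} (hγ : Continuous γ) :
    Continuous (graphMap e γ) := by
  unfold graphMap; fun_prop

theorem continuous_graphChart {e : E} {γ : (ℝ ∙ e)ᗮ → ℝ} (hγ : Continuous γ) :
    Continuous (graphChart e γ) := by
  unfold graphChart; fun_prop

theorem contDiff_graphMap {e : E} {γ : (ℝ ∙ e)ᗮ → ℝ} (hγ : ContDiff ℝ 1 γ) :
    ContDiff ℝ 1 (graphMap e γ) := by
  unfold graphMap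
  exact ((ℝ ∙ e)ᗮ.subtypeL.contDiff).add (hγ.smul contDiff_const)

theorem hasFDerivAt_graphMap {e : E} {γ : (ℝ ∙ e)ᗮ → ℝ} {γ' : (ℝ ∙ e)ᗮ →L[ℝ] ℝ} {y : (ℝ ∙ e)ᗮ}
    (hγ : HasFDerivAt γ γ' y) :
    HasFDerivAt (graphMap e γ) ((ℝ ∙ e)ᗮ.subtypeL + γ'.smulRight e) y :=
  ((ℝ ∙ e)ᗮ.subtypeL.hasFDerivAt (x := y)).add (hγ.smul_const e)

variable [FiniteDimensional ℝ E]

theorem injective_subtypeL_add_smulRight (e : E) (γ' : (ℝ ∙ e)ᗮ →L[ℝ] ℝ) :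
    Function.Injective ((ℝ ∙ e)ᗮ.subtypeL + γ'.smulRight e) := fun x y h => by
  have := congrArg (ℝ ∙ e)ᗮ.orthogonalProjectionOnto h
  simpa only [add_apply, Submodule.subtypeL_apply,
    ContinuousLinearMap.smulRight_apply, orthogonalProjectionOnto_add_smul] using this

/-- For L y = y + ⟨p, y⟩e, orthogonality of e to the hyperplane gives L*L = I + p ⊗ p, a
transvection of determinant 1 + ‖p‖². -/
theorem normDet_subtypeL_add_smulRight {e : E} (he : ‖e‖ = 1) (p : (ℝ ∙ e)ᗮ) :
    ((ℝ ∙ e)ᗮ.subtypeL + (toDual ℝ _ p).smulRight e).toLinearMap.normDet = √(1 + ‖p‖ ^ 2) := by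
  set L := (ℝ ∙ e)ᗮ.subtypeL + (toDual ℝ _ p).smulRight e with hL
  have h1 : L.toLinearMap.normDet ^ 2 = (L.toLinearMap.adjoint ∘ₗ L.toLinearMap).det := by
    simpa using L.toLinearMap.normDet_sq
  have h2 : L.toLinearMap.adjoint ∘ₗ L.toLinearMap =
      LinearMap.transvection (toDual ℝ _ p).toLinearMap p := by
    ext1 h
    refine ext_inner_right ℝ fun k => ?_
    rw [LinearMap.comp_apply, LinearMap.adjoint_inner_left, LinearMap.transvection.apply]
    have h0 := inner_coe_orthogonal_span_singleton e k
    have h0' : inner ℝ (h : E) e = 0 := by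
      rw [real_inner_comm]; exact inner_coe_orthogonal_span_singleton e h
    simp [hL, inner_add_left, inner_add_right, inner_smul_left, inner_smul_right, h0, h0', he, mul_comm]
  rw [h2, LinearMap.transvection.det] at h1
  rw [← Real.sqrt_sq (LinearMap.normDet_nonneg L.toLinearMap), h1]
  simp

theorem normDet_fderiv_graphMap {e : E} (he : ‖e‖ = 1) {γ : (ℝ ∙ e)ᗮ → ℝ} (hγ : ContDiff ℝ 1 γ)
    (y : (ℝ ∙ e)ᗮ) :
    (fderiv ℝ (graphMap e γ) y).toLinearMap.normDet = √(1 + ‖gradient γ y‖ ^ 2) := by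
  have h := (hγ.differentiable one_ne_zero y).hasGradientAt.hasFDerivAt
  rw [(hasFDerivAt_graphMap h).fderiv, normDet_subtypeL_add_smulRight he]

variable [MeasurableSpace E] [BorelSpace E]

theorem map_graphMap_withDensity {e : E} (he : ‖e‖ = 1) {γ : (ℝ ∙ e)ᗮ → ℝ} (hγ : ContDiff ℝ 1 γ) :
    (volume.withDensity fun y => ENNReal.ofReal √(1 + ‖gradient γ y‖ ^ 2)).map (graphMap e γ) =
      (μHE[Module.finrank ℝ E - 1]).restrict (range (graphMap e γ)) := by
  have hd : Module.finrank ℝ (ℝ ∙ e)ᗮ = Module.finrank ℝ E - 1 := by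
    have h1 := Submodule.finrank_add_finrank_orthogonal (ℝ ∙ e)
    rw [finrank_span_singleton (by rintro rfl; simp at he)] at h1
    omega
  have h := euclideanHausdorffMeasure_image_eq_lintegral (contDiff_graphMap hγ)
    (graphMap_injective he γ) fun y => by
      rw [(hasFDerivAt_graphMap (hγ.differentiable one_ne_zero y).hasFDerivAt).fderiv]
      exact injective_subtypeL_add_smulRight e _
  simp_rw [normDet_fderiv_graphMap he hγ, hd] at h
  exact h

theorem measurableEmbedding_graphMap {e : E} (he : ‖e‖ = 1) {γ : (ℝ ∙ e)ᗮ → ℝ}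
    (hγ : Continuous γ) : MeasurableEmbedding (graphMap e γ) :=
  (continuous_graphMap hγ).measurableEmbedding (graphMap_injective he γ)

theorem continuous_gradient {K : Type*} [NormedAddCommGroup K] [InnerProductSpace ℝ K]
    [CompleteSpace K] {γ : K → ℝ} (hγ : ContDiff ℝ 1 γ) : Continuous (gradient γ) :=
  (toDual ℝ K).symm.continuous.comp (hγ.continuous_fderiv one_ne_zero)

theorem integrableOn_range_graphMap_iff {e : E} (he : ‖e‖ = 1) {γ : (ℝ ∙ e)ᗮ → ℝ}
    (hγ : ContDiff ℝ 1 γ) (h : E → ℝ) :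
    IntegrableOn h (range (graphMap e γ)) μHE[Module.finrank ℝ E - 1] ↔
      Integrable fun y => √(1 + ‖gradient γ y‖ ^ 2) * h (graphMap e γ y) := by
  rw [IntegrableOn, ← map_graphMap_withDensity he hγ,
    (measurableEmbedding_graphMap he hγ.continuous).integrable_map_iff]
  have hc := continuous_gradient hγ
  rw [integrable_withDensity_iff_integrable_smul' (by fun_prop) (by simp)]
  simp only [ENNReal.toReal_ofReal (Real.sqrt_nonneg _), smul_eq_mul, Function.comp]

theorem setIntegral_range_graphMap {e : E} (he : ‖e‖ = 1) {γ : (ℝ ∙ e)ᗮ → ℝ}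
    (hγ : ContDiff ℝ 1 γ) (h : E → ℝ) :
    ∫ x in range (graphMap e γ), h x ∂μHE[Module.finrank ℝ E - 1] =
      ∫ y, √(1 + ‖gradient γ y‖ ^ 2) * h (graphMap e γ y) := by
  rw [← map_graphMap_withDensity he hγ,
    (measurableEmbedding_graphMap he hγ.continuous).integral_map]
  have hc := continuous_gradient hγ
  rw [integral_withDensity_eq_integral_toReal_smul (by fun_prop) (by simp)]
  simp only [ENNReal.toReal_ofReal (Real.sqrt_nonneg _), smul_eq_mul]

theorem measurePreserving_add_smul {e : E} (he : ‖e‖ = 1) :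
    MeasurePreserving (fun p : (ℝ ∙ e)ᗮ × ℝ => (p.1 : E) + p.2 • e) := by
  have h1 : MeasurePreserving (LinearIsometryEquiv.toSpanUnitSingleton (𝕜 := ℝ) e he) :=
    LinearIsometryEquiv.measurePreserving _
  have h2 : MeasurePreserving (Prod.map (LinearIsometryEquiv.toSpanUnitSingleton (𝕜 := ℝ) e he)
      (id : (ℝ ∙ e)ᗮ → (ℝ ∙ e)ᗮ)) := h1.prod (MeasurePreserving.id _)
  have h3 : MeasurePreserving ((ℝ ∙ e).orthogonalDecomposition.symm) :=
    LinearIsometryEquiv.measurePreserving _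
  have h4 := h3.comp ((WithLp.volume_preserving_toLp (ℝ ∙ e) (ℝ ∙ e)ᗮ).comp
    (h2.comp (Measure.measurePreserving_swap (μ := (volume : Measure (ℝ ∙ e)ᗮ))
      (ν := (volume : Measure ℝ)))))
  convert! h4 using 2 with p
  simp [add_comm]

/-- The chart is the shear (y, t) ↦ (y, γ y + t), a translation on each vertical line, followed by
the orthogonal splitting of the space. Hence no Jacobian appears and continuity of γ suffices. -/
theorem measurePreserving_graphChart {e : E} (he : ‖e‖ = 1) {γ : (ℝ ∙ e)ᗮ → ℝ}
    (hγ : Continuous γ) : MeasurePreserving (graphChart e γ) := by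
  have h1 : MeasurePreserving (fun p : (ℝ ∙ e)ᗮ × ℝ => (p.1, γ p.1 + p.2)) :=
    (MeasurePreserving.id volume).skew_product (g := fun y t => γ y + t) (by fun_prop)
      (ae_of_all _ fun y => map_add_left_eq_self volume (γ y))
  exact (measurePreserving_add_smul he).comp h1

theorem measurableEmbedding_graphChart {e : E} (he : ‖e‖ = 1) {γ : (ℝ ∙ e)ᗮ → ℝ}
    (hγ : Continuous γ) : MeasurableEmbedding (graphChart e γ) :=
  (continuous_graphChart hγ).measurableEmbedding (graphChart_injective he γ)

end Graph

/-! ### Divergence theorem above a C¹ graph -/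

section EpigraphDivergence

open Filter Topology Set
open scoped NNReal ENNReal

variable {E : Type*} [NormedAddCommGroup E] [InnerProductSpace ℝ E] [FiniteDimensional ℝ E]

/-- The open region strictly above the graph of `γ`. -/
def strictEpigraph (e : E) (γ : (ℝ ∙ e)ᗮ → ℝ) : Set E :=
  {x | γ ((ℝ ∙ e)ᗮ.orthogonalProjectionOnto x) < inner ℝ e x}

/-- The closed region above the graph of `γ`. -/
def closedEpigraph (e : E) (γ : (ℝ ∙ e)ᗮ → ℝ) : Set E :=
  {x | γ ((ℝ ∙ e)ᗮ.orthogonalProjectionOnto x) ≤ inner ℝ e x}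

omit [FiniteDimensional ℝ E] in
theorem isOpen_strictEpigraph {e : E} {γ : (ℝ ∙ e)ᗮ → ℝ} (hγ : Continuous γ) :
    IsOpen (strictEpigraph e γ) :=
  isOpen_lt (by fun_prop) (by fun_prop)

omit [FiniteDimensional ℝ E] in
theorem isClosed_closedEpigraph {e : E} {γ : (ℝ ∙ e)ᗮ → ℝ} (hγ : Continuous γ) :
    IsClosed (closedEpigraph e γ) :=
  isClosed_le (by fun_prop) (by fun_prop)

theorem orthogonalProjectionOnto_graphChart (e : E) (γ : (ℝ ∙ e)ᗮ → ℝ) (p : (ℝ ∙ e)ᗮ × ℝ) :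
    (ℝ ∙ e)ᗮ.orthogonalProjectionOnto (graphChart e γ p) = p.1 :=
  orthogonalProjectionOnto_add_smul e _ _

omit [FiniteDimensional ℝ E] in
theorem inner_graphChart {e : E} (he : ‖e‖ = 1) (γ : (ℝ ∙ e)ᗮ → ℝ) (p : (ℝ ∙ e)ᗮ × ℝ) :
    inner ℝ e (graphChart e γ p) = γ p.1 + p.2 :=
  inner_add_smul he _ _

theorem graphChart_mem_strictEpigraph {e : E} (he : ‖e‖ = 1) {γ : (ℝ ∙ e)ᗮ → ℝ}
    {p : (ℝ ∙ e)ᗮ × ℝ} : graphChart e γ p ∈ strictEpigraph e γ ↔ 0 < p.2 := by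
  simp only [strictEpigraph, mem_ofPred_eq, orthogonalProjectionOnto_graphChart,
    inner_graphChart he, lt_add_iff_pos_right]

theorem graphChart_mem_closedEpigraph {e : E} (he : ‖e‖ = 1) {γ : (ℝ ∙ e)ᗮ → ℝ}
    {p : (ℝ ∙ e)ᗮ × ℝ} : graphChart e γ p ∈ closedEpigraph e γ ↔ 0 ≤ p.2 := by
  simp only [closedEpigraph, mem_ofPred_eq, orthogonalProjectionOnto_graphChart,
    inner_graphChart he, le_add_iff_nonneg_right]

theorem integral_fderiv_eq_zero_of_hasCompactSupport {K : Type*} [NormedAddCommGroup K]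
    [NormedSpace ℝ K] [FiniteDimensional ℝ K] [MeasurableSpace K] [BorelSpace K] {μ : Measure K}
    [μ.IsAddHaarMeasure] {φ : K → ℝ} (hφ : ContDiff ℝ 1 φ) (hc : HasCompactSupport φ) (a : K) :
    ∫ y, fderiv ℝ φ y a ∂μ = 0 := by
  have hcont : Continuous fun y => fderiv ℝ φ y a :=
    (hφ.continuous_fderiv one_ne_zero).clm_apply continuous_const
  have hsupp : HasCompactSupport fun y => fderiv ℝ φ y a := hc.fderiv_apply ℝ a
  have h := integral_mul_fderiv_eq_neg_fderiv_mul_of_integrable (μ := μ) (𝕜 := ℝ)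
    (f := fun _ : K => (1 : ℝ)) (g := φ) (v := a) (by simp)
    (by simpa using hcont.integrable_of_hasCompactSupport hsupp)
    (by simpa using hφ.continuous.integrable_of_hasCompactSupport hc)
    (fun _ _ => differentiableAt_const _) (fun x _ => hφ.differentiable one_ne_zero x)
  simpa using h

/-- A compactly supported function which is `C¹` with bounded derivative above the graph of `γ` and
continuous up to the graph. -/
structure IsC1AboveGraph (e : E) (γ : (ℝ ∙ e)ᗮ → ℝ) (f : E → ℝ) : Prop where
  hasCompactSupport : HasCompactSupport f
  contDiffOn : ContDiffOn ℝ 1 f (strictEpigraph e γ)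
  continuousOn : ContinuousOn f (closedEpigraph e γ)
  bounded : ∃ C, ∀ x ∈ strictEpigraph e γ, ‖fderiv ℝ f x‖ ≤ C

namespace IsC1AboveGraph

variable {e : E} {γ : (ℝ ∙ e)ᗮ → ℝ} {f : E → ℝ}

omit [FiniteDimensional ℝ E] in
theorem differentiableAt (hf : IsC1AboveGraph e γ f) (hγ : Continuous γ) {x : E}
    (hx : x ∈ strictEpigraph e γ) : DifferentiableAt ℝ f x :=
  (hf.contDiffOn.differentiableOn one_ne_zero).differentiableAt
    ((isOpen_strictEpigraph hγ).mem_nhds hx)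

omit [FiniteDimensional ℝ E] in
theorem continuousOn_fderiv_apply (hf : IsC1AboveGraph e γ f) (hγ : Continuous γ) (a : E) :
    ContinuousOn (fun x => fderiv ℝ f x a) (strictEpigraph e γ) :=
  (hf.contDiffOn.continuousOn_fderiv_of_isOpen (isOpen_strictEpigraph hγ) le_rfl).clm_apply
    continuousOn_const

omit [FiniteDimensional ℝ E] in
theorem norm_fderiv_apply_le (hf : IsC1AboveGraph e γ f) (a : E) :
    ∃ C, ∀ x ∈ strictEpigraph e γ, ‖fderiv ℝ f x a‖ ≤ C := by
  obtain ⟨C, hC⟩ := hf.bounded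
  exact ⟨C * ‖a‖, fun x hx => ((fderiv ℝ f x).le_opNorm a).trans (by gcongr; exact hC x hx)⟩

variable [MeasurableSpace E] [BorelSpace E]

theorem integrableOn_mul_fderiv_apply (hf : IsC1AboveGraph e γ f) (hγ : Continuous γ) (a : E)
    {c : E → ℝ} (hc : Continuous c) :
    IntegrableOn (fun x => c x * fderiv ℝ f x a) (strictEpigraph e γ) := by
  have hU := (isOpen_strictEpigraph hγ).measurableSet
  have hS : MeasurableSet (tsupport f) := (isClosed_tsupport f).measurableSet
  obtain ⟨C, hC⟩ := hf.norm_fderiv_apply_le a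
  have h1 : IntegrableOn (fun x => fderiv ℝ f x a) (strictEpigraph e γ ∩ tsupport f) := by
    refine IntegrableOn.of_bound ?_ ?_ C ?_
    · exact (measure_mono inter_subset_right).trans_lt
        hf.hasCompactSupport.isCompact.measure_lt_top
    · exact ((hf.continuousOn_fderiv_apply hγ a).mono inter_subset_left).aestronglyMeasurable
        (hU.inter hS)
    · exact (ae_restrict_iff' (hU.inter hS)).2 (ae_of_all _ fun x hx => hC x hx.1)
  have h2 := IntegrableOn.continuousOn_mul_of_subset hc.continuousOn h1 hf.hasCompactSupport.isCompact
    (hU.inter hS) inter_subset_right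
  refine h2.of_forall_sdiff_eq_zero hU fun x hx => ?_
  have hx' : x ∉ tsupport f := fun h => hx.2 ⟨hx.1, h⟩
  rw [fderiv_of_notMem_tsupport ℝ hx']
  simp

omit [FiniteDimensional ℝ E] [MeasurableSpace E] [BorelSpace E] in
theorem exists_forall_eq_zero (hf : IsC1AboveGraph e γ f) (he : ‖e‖ = 1) :
    ∃ R, ∀ p : (ℝ ∙ e)ᗮ × ℝ, R < γ p.1 + p.2 → graphChart e γ p ∉ tsupport f := by
  obtain ⟨R, hR⟩ := hf.hasCompactSupport.isCompact.isBounded.exists_norm_le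
  refine ⟨R, fun p hp h => ?_⟩
  have h1 := hR _ h
  have h2 := real_inner_le_norm e (graphChart e γ p)
  rw [inner_graphChart he, he, one_mul] at h2
  linarith

omit [MeasurableSpace E] [BorelSpace E] in
theorem hasDerivAt_graphChart (hf : IsC1AboveGraph e γ f) (he : ‖e‖ = 1) (hγ : Continuous γ)
    (y : (ℝ ∙ e)ᗮ) {t : ℝ} (ht : 0 < t) :
    HasDerivAt (fun t => f (graphChart e γ (y, t))) (fderiv ℝ f (graphChart e γ (y, t)) e) t := by
  have h1 : HasDerivAt (fun t : ℝ => graphChart e γ (y, t)) e t := by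
    simpa [graphChart] using
      (((hasDerivAt_id t).const_add (γ y)).smul_const e).const_add (y : E)
  exact (hf.differentiableAt hγ ((graphChart_mem_strictEpigraph he).2 ht)).hasFDerivAt.comp_hasDerivAt
    t h1

-- Fundamental theorem of calculus on a vertical half-line: compact support kills the contribution
-- at infinity, and continuity up to the graph supplies the value at t = 0.
omit [MeasurableSpace E] [BorelSpace E] in
theorem integral_Ioi_fderiv_graphChart (hf : IsC1AboveGraph e γ f) (he : ‖e‖ = 1)
    (hγ : Continuous γ) (y : (ℝ ∙ e)ᗮ) :
    ∫ t in Ioi (0 : ℝ), fderiv ℝ f (graphChart e γ (y, t)) e = - f (graphMap e γ y) := by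
  obtain ⟨R, hR⟩ := hf.exists_forall_eq_zero he
  obtain ⟨C, hC⟩ := hf.norm_fderiv_apply_le e
  have hcont : Continuous fun t : ℝ => graphChart e γ (y, t) :=
    (continuous_graphChart hγ).comp (by fun_prop)
  have hzero : ∀ t, R - γ y < t → graphChart e γ (y, t) ∉ tsupport f := fun t ht =>
    hR (y, t) (by simp only; linarith)
  have h1 : ContinuousWithinAt (fun t => f (graphChart e γ (y, t))) (Ici 0) 0 := by
    refine ContinuousWithinAt.comp (t := closedEpigraph e γ) (hf.continuousOn _ ?_)
      hcont.continuousWithinAt fun t ht => (graphChart_mem_closedEpigraph he).2 ht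
    exact (graphChart_mem_closedEpigraph he).2 le_rfl
  have h2 : IntegrableOn (fun t => fderiv ℝ f (graphChart e γ (y, t)) e) (Ioi 0) := by
    have h3 : IntegrableOn (fun t => fderiv ℝ f (graphChart e γ (y, t)) e)
        (Ioc 0 (R - γ y)) := by
      refine IntegrableOn.of_bound (by simp) ?_ C ?_
      · exact ((hf.continuousOn_fderiv_apply hγ e).comp hcont.continuousOn fun t ht =>
          (graphChart_mem_strictEpigraph he).2 ht.1).aestronglyMeasurable measurableSet_Ioc
      · exact (ae_restrict_iff' measurableSet_Ioc).2 (ae_of_all _ fun t ht =>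
          hC _ ((graphChart_mem_strictEpigraph he).2 ht.1))
    refine h3.of_forall_sdiff_eq_zero measurableSet_Ioi fun t ht => ?_
    have ht' : R - γ y < t := by
      by_contra h
      exact ht.2 ⟨ht.1, not_lt.1 h⟩
    rw [fderiv_of_notMem_tsupport ℝ (hzero t ht')]
    simp
  have h3 := integral_Ioi_of_hasDerivAt_of_tendsto h1
    (fun t ht => hf.hasDerivAt_graphChart he hγ y ht) h2 (m := 0) (by
      refine tendsto_const_nhds.congr' ?_
      filter_upwards [eventually_gt_atTop (R - γ y)] with t ht
      exact (image_eq_zero_of_notMem_tsupport (hzero t ht)).symm)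
  rw [h3, graphChart_zero, zero_sub]

omit [MeasurableSpace E] [BorelSpace E] in
theorem contDiff_graphChart (hf : IsC1AboveGraph e γ f) (he : ‖e‖ = 1) (hγ : ContDiff ℝ 1 γ)
    {t : ℝ} (ht : 0 < t) : ContDiff ℝ 1 fun y => f (graphChart e γ (y, t)) := by
  have h1 : ContDiff ℝ 1 fun y : (ℝ ∙ e)ᗮ => graphChart e γ (y, t) := by
    unfold graphChart
    exact ((ℝ ∙ e)ᗮ.subtypeL.contDiff).add ((hγ.add contDiff_const).smul contDiff_const)
  exact hf.contDiffOn.comp_contDiff h1 fun y => (graphChart_mem_strictEpigraph he).2 ht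

omit [MeasurableSpace E] [BorelSpace E] in
theorem hasCompactSupport_graphChart (hf : IsC1AboveGraph e γ f) (t : ℝ) :
    HasCompactSupport fun y => f (graphChart e γ (y, t)) := by
  refine HasCompactSupport.intro (K := (ℝ ∙ e)ᗮ.orthogonalProjectionOnto '' tsupport f)
    (hf.hasCompactSupport.isCompact.image (by fun_prop)) fun y hy => ?_
  refine image_eq_zero_of_notMem_tsupport fun h => hy ?_
  exact ⟨_, h, orthogonalProjectionOnto_graphChart e γ (y, t)⟩

omit [MeasurableSpace E] [BorelSpace E] in
theorem fderiv_graphChart_apply (hf : IsC1AboveGraph e γ f) (he : ‖e‖ = 1) (hγ : ContDiff ℝ 1 γ)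
    {t : ℝ} (ht : 0 < t) (y a : (ℝ ∙ e)ᗮ) :
    fderiv ℝ (fun y => f (graphChart e γ (y, t))) y a =
      fderiv ℝ f (graphChart e γ (y, t)) a +
        fderiv ℝ γ y a * fderiv ℝ f (graphChart e γ (y, t)) e := by
  have hγ' := (hγ.differentiable one_ne_zero y).hasFDerivAt
  have h1 : HasFDerivAt (fun y : (ℝ ∙ e)ᗮ => graphChart e γ (y, t))
      ((ℝ ∙ e)ᗮ.subtypeL + (fderiv ℝ γ y).smulRight e) y :=
    ((ℝ ∙ e)ᗮ.subtypeL.hasFDerivAt (x := y)).add ((hγ'.add_const t).smul_const e)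
  have h2 := (hf.differentiableAt hγ.continuous
    ((graphChart_mem_strictEpigraph (p := (y, t)) he).2 ht)).hasFDerivAt.comp y h1
  have h3 := h2.fderiv
  simp only [Function.comp_def] at h3
  rw [h3]
  simp

theorem setIntegral_strictEpigraph (he : ‖e‖ = 1) (hγ : Continuous γ) (h : E → ℝ) :
    ∫ x in strictEpigraph e γ, h x = ∫ p in univ ×ˢ Ioi (0 : ℝ), h (graphChart e γ p) := by
  rw [← (measurePreserving_graphChart he hγ).setIntegral_preimage_emb
    (measurableEmbedding_graphChart he hγ)]
  congr 2
  ext p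
  simp [graphChart_mem_strictEpigraph he]

theorem integrableOn_graphChart (he : ‖e‖ = 1) (hγ : Continuous γ) {h : E → ℝ}
    (hh : IntegrableOn h (strictEpigraph e γ)) :
    IntegrableOn (fun p => h (graphChart e γ p)) (univ ×ˢ Ioi (0 : ℝ)) := by
  rw [← (measurePreserving_graphChart he hγ).integrableOn_comp_preimage
    (measurableEmbedding_graphChart he hγ)] at hh
  convert! hh using 1
  ext p
  simp [graphChart_mem_strictEpigraph he]

theorem setIntegral_mul_fderiv_vertical (hf : IsC1AboveGraph e γ f) (he : ‖e‖ = 1)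
    (hγ : Continuous γ) {c : (ℝ ∙ e)ᗮ → ℝ} (hc : Continuous c) :
    ∫ x in strictEpigraph e γ, c ((ℝ ∙ e)ᗮ.orthogonalProjectionOnto x) * fderiv ℝ f x e =
      - ∫ y, c y * f (graphMap e γ y) := by
  have hi := integrableOn_graphChart he hγ
    (hf.integrableOn_mul_fderiv_apply hγ e (c := fun x => c ((ℝ ∙ e)ᗮ.orthogonalProjectionOnto x))
      (by fun_prop))
  rw [setIntegral_strictEpigraph he hγ, Measure.volume_eq_prod, setIntegral_prod _ hi,
    setIntegral_univ, ← integral_neg]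
  refine integral_congr_ae (ae_of_all _ fun y => ?_)
  simp only [orthogonalProjectionOnto_graphChart]
  rw [integral_const_mul, hf.integral_Ioi_fderiv_graphChart he hγ]
  ring

/-- In graph coordinates the integrand is the derivative along a of the slice y ↦ f(y, t) at fixed
height t > 0 above the graph. Each slice is C¹ with compact support, so its derivative integrates to
zero; Fubini is applied with t as the outer variable. -/
theorem setIntegral_fderiv_tangential (hf : IsC1AboveGraph e γ f) (he : ‖e‖ = 1)
    (hγ : ContDiff ℝ 1 γ) (a : (ℝ ∙ e)ᗮ) :
    ∫ x in strictEpigraph e γ, (fderiv ℝ f x a +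
      fderiv ℝ γ ((ℝ ∙ e)ᗮ.orthogonalProjectionOnto x) a * fderiv ℝ f x e) = 0 := by
  have hγ' : Continuous fun y => fderiv ℝ γ y a :=
    (hγ.continuous_fderiv one_ne_zero).clm_apply continuous_const
  have hi : IntegrableOn (fun x => fderiv ℝ f x a +
      fderiv ℝ γ ((ℝ ∙ e)ᗮ.orthogonalProjectionOnto x) a * fderiv ℝ f x e)
      (strictEpigraph e γ) := by
    refine Integrable.add ?_ (hf.integrableOn_mul_fderiv_apply hγ.continuous e
      (c := fun x => fderiv ℝ γ ((ℝ ∙ e)ᗮ.orthogonalProjectionOnto x) a)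
      (hγ'.comp (by fun_prop)))
    simpa [IntegrableOn] using hf.integrableOn_mul_fderiv_apply hγ.continuous (a : E)
      (c := fun _ => 1) continuous_const
  have hi' := integrableOn_graphChart he hγ.continuous hi
  rw [setIntegral_strictEpigraph he hγ.continuous, Measure.volume_eq_prod,
    ← setIntegral_prod_swap, setIntegral_prod]
  · refine Eq.trans ?_ (integral_zero ℝ ℝ (μ := volume.restrict (Ioi (0 : ℝ))))
    refine setIntegral_congr_fun measurableSet_Ioi fun t ht => ?_
    simp only [setIntegral_univ, Prod.swap_prod_mk, orthogonalProjectionOnto_graphChart]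
    rw [← integral_fderiv_eq_zero_of_hasCompactSupport (μ := volume)
      (hf.contDiff_graphChart he hγ ht) (hf.hasCompactSupport_graphChart t) a]
    simp_rw [hf.fderiv_graphChart_apply he hγ ht]
  · exact hi'.swap

/-- The divergence theorem above the graph of a `C¹` function. -/
theorem setIntegral_fderiv (hf : IsC1AboveGraph e γ f) (he : ‖e‖ = 1) (hγ : ContDiff ℝ 1 γ)
    (a : E) :
    ∫ x in strictEpigraph e γ, fderiv ℝ f x a =
      ∫ y, f (graphMap e γ y) * inner ℝ (((gradient γ y : (ℝ ∙ e)ᗮ) : E) - e) a := by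
  set P := (ℝ ∙ e)ᗮ.orthogonalProjectionOnto with hP
  have hγ' : Continuous fun y => fderiv ℝ γ y (P a) :=
    (hγ.continuous_fderiv one_ne_zero).clm_apply continuous_const
  have h1 := hf.setIntegral_fderiv_tangential he hγ (P a)
  have h2 := hf.setIntegral_mul_fderiv_vertical he hγ.continuous
    (c := fun y => inner ℝ e a - fderiv ℝ γ y (P a)) (by fun_prop)
  have hia : ∀ b : E, IntegrableOn (fun x => fderiv ℝ f x b) (strictEpigraph e γ) := fun b => by
    simpa using hf.integrableOn_mul_fderiv_apply hγ.continuous b (c := fun _ => 1)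
      continuous_const
  have hi1 : IntegrableOn (fun x => fderiv ℝ f x (P a) +
      fderiv ℝ γ (P x) (P a) * fderiv ℝ f x e) (strictEpigraph e γ) :=
    (hia _).add (hf.integrableOn_mul_fderiv_apply hγ.continuous e
      (c := fun x => fderiv ℝ γ (P x) (P a)) (hγ'.comp (by fun_prop)))
  have hi2 : IntegrableOn (fun x => (inner ℝ e a - fderiv ℝ γ (P x) (P a)) * fderiv ℝ f x e)
      (strictEpigraph e γ) :=
    hf.integrableOn_mul_fderiv_apply hγ.continuous e
      (c := fun x => inner ℝ e a - fderiv ℝ γ (P x) (P a))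
      (continuous_const.sub (hγ'.comp (by fun_prop)))
  -- Split a = Pa + ⟨e, a⟩e, then add and subtract the vertical correction that turns ∂_{Pa} into a
  -- derivative along graph-parallel slices. The remaining vertical term has a coefficient depending
  -- only on the projection of x.
  have h3 : ∫ x in strictEpigraph e γ, fderiv ℝ f x a =
      ∫ x in strictEpigraph e γ, ((fderiv ℝ f x (P a) +
        fderiv ℝ γ (P x) (P a) * fderiv ℝ f x e) +
        (inner ℝ e a - fderiv ℝ γ (P x) (P a)) * fderiv ℝ f x e) := by
    refine integral_congr_ae (ae_of_all _ fun x => ?_)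
    have : fderiv ℝ f x a = fderiv ℝ f x ((P a : E) + inner ℝ e a • e) := by
      rw [hP, orthogonalProjectionOnto_add_inner_smul he]
    simp only [this, map_add, map_smul, smul_eq_mul]
    ring
  rw [h3, integral_add hi1 hi2, h1, h2, zero_add, ← integral_neg]
  refine integral_congr_ae (ae_of_all _ fun y => ?_)
  have h4 : fderiv ℝ γ y (P a) = inner ℝ ((gradient γ y : (ℝ ∙ e)ᗮ) : E) a := by
    rw [(hγ.differentiable one_ne_zero y).hasGradientAt.hasFDerivAt.fderiv, toDual_apply_apply,
      hP, Submodule.inner_orthogonalProjectionOnto_eq_of_mem_left]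
  simp only [h4, inner_sub_left]
  ring

end IsC1AboveGraph

end EpigraphDivergence

/-! ### Local geometry of a C¹ boundary and uniqueness of the normal -/

section BoundaryGeometry

open Filter Topology Set
open scoped NNReal ENNReal

variable {E : Type*} [NormedAddCommGroup E] [InnerProductSpace ℝ E] [FiniteDimensional ℝ E]

/-- The vector `e - ∇γ`, pointing above the graph of `γ`. -/
noncomputable def upwardNormal (e : E) (γ : (ℝ ∙ e)ᗮ → ℝ) (y : (ℝ ∙ e)ᗮ) : E :=
  e - ((gradient γ y : (ℝ ∙ e)ᗮ) : E)

theorem norm_upwardNormal {e : E} (he : ‖e‖ = 1) (γ : (ℝ ∙ e)ᗮ → ℝ) (y : (ℝ ∙ e)ᗮ) :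
    ‖upwardNormal e γ y‖ = √(1 + ‖gradient γ y‖ ^ 2) := by
  have h : ‖upwardNormal e γ y‖ ^ 2 = 1 + ‖gradient γ y‖ ^ 2 := by
    rw [upwardNormal, norm_sub_sq_real, inner_coe_orthogonal_span_singleton, he]
    simp
  rw [← h, Real.sqrt_sq (norm_nonneg _)]

theorem norm_upwardNormal_pos {e : E} (he : ‖e‖ = 1) (γ : (ℝ ∙ e)ᗮ → ℝ) (y : (ℝ ∙ e)ᗮ) :
    0 < ‖upwardNormal e γ y‖ := by
  rw [norm_upwardNormal he]; positivity

theorem hasFDerivAt_inner_sub_comp_projection {e : E} {γ : (ℝ ∙ e)ᗮ → ℝ}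
    (hγ : ContDiff ℝ 1 γ) (y : E) :
    HasFDerivAt (fun z => inner ℝ e z - γ ((ℝ ∙ e)ᗮ.orthogonalProjectionOnto z))
      (toDual ℝ E (upwardNormal e γ ((ℝ ∙ e)ᗮ.orthogonalProjectionOnto y))) y := by
  set P := (ℝ ∙ e)ᗮ.orthogonalProjectionOnto with hP
  have h1 : HasFDerivAt (fun z => γ (P z)) ((toDual ℝ _ (gradient γ (P y))).comp P) y :=
    (hγ.differentiable one_ne_zero (P y)).hasGradientAt.hasFDerivAt.comp y P.hasFDerivAt
  have h2 : HasFDerivAt (fun z => inner ℝ e z) (toDual ℝ E e) y := (toDual ℝ E e).hasFDerivAt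
  convert! h2.sub h1 using 1
  ext h
  simp only [toDual_apply_apply, upwardNormal, inner_sub_left, sub_apply,
    ContinuousLinearMap.comp_apply, hP, Submodule.inner_orthogonalProjectionOnto_eq_of_mem_left]

/-- A small upward shift along e enters the strict epigraph while staying in the open ball. -/
theorem mem_closedEpigraph_mem_closure_inter {e : E} (he : ‖e‖ = 1) {γ : (ℝ ∙ e)ᗮ → ℝ} {x : E}
    {r : ℝ} {y : E} (hy : y ∈ closedEpigraph e γ) (hyB : y ∈ Metric.ball x r) :
    y ∈ closure (strictEpigraph e γ ∩ Metric.ball x r) := by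
  have hcont : Continuous fun t : ℝ => y + t • e := by fun_prop
  have hlim : Tendsto (fun t : ℝ => y + t • e) (𝓝[>] 0) (𝓝 y) := by
    have := hcont.tendsto 0
    simp only [zero_smul, add_zero] at this
    exact this.mono_left nhdsWithin_le_nhds
  refine mem_closure_of_tendsto hlim ?_
  filter_upwards [self_mem_nhdsWithin, hlim (Metric.isOpen_ball.mem_nhds hyB)] with t ht htB
  refine ⟨?_, htB⟩
  have hPe : (ℝ ∙ e)ᗮ.orthogonalProjectionOnto e = 0 := by
    have := orthogonalProjectionOnto_add_smul e 0 1
    simpa only [ZeroMemClass.coe_zero, one_smul, zero_add] using this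
  have hy' : γ ((ℝ ∙ e)ᗮ.orthogonalProjectionOnto y) ≤ inner ℝ e y := hy
  have ht' : (0 : ℝ) < t := ht
  simp only [strictEpigraph, mem_ofPred_eq, map_add, map_smul, hPe, smul_zero, add_zero,
    inner_add_right, inner_smul_right, real_inner_self_eq_norm_sq, he]
  linarith

omit [FiniteDimensional ℝ E] in
theorem strictEpigraph_subset_closedEpigraph (e : E) (γ : (ℝ ∙ e)ᗮ → ℝ) :
    strictEpigraph e γ ⊆ closedEpigraph e γ := fun z hz => by
  simp only [strictEpigraph, closedEpigraph, mem_ofPred_eq] at hz ⊢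
  exact hz.le

namespace IsC1BoundaryGraph

variable {Ω : Set E} {x e : E} {r : ℝ} {γ : (ℝ ∙ e)ᗮ → ℝ}

omit [FiniteDimensional ℝ E] in
theorem inter_ball (h : IsC1BoundaryGraph Ω x e r γ) :
    Ω ∩ Metric.ball x r = strictEpigraph e γ ∩ Metric.ball x r := by
  ext y
  exact and_congr_left fun hy => h.mem_iff y hy

theorem closure_inter_ball (h : IsC1BoundaryGraph Ω x e r γ) :
    closure Ω ∩ Metric.ball x r = closedEpigraph e γ ∩ Metric.ball x r := by
  refine Subset.antisymm (fun y hy => ⟨?_, hy.2⟩) (fun y hy => ⟨?_, hy.2⟩)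
  · have h1 : y ∈ closure (Ω ∩ Metric.ball x r) := by
      rw [inter_comm] at hy ⊢
      exact Metric.isOpen_ball.inter_closure hy
    rw [h.inter_ball] at h1
    refine closure_minimal ?_ (isClosed_closedEpigraph h.contDiff.continuous) h1
    exact inter_subset_left.trans (strictEpigraph_subset_closedEpigraph e γ)
  · have h1 := mem_closedEpigraph_mem_closure_inter h.norm_direction hy.1 hy.2
    rw [← h.inter_ball] at h1
    exact closure_mono inter_subset_left h1

theorem frontier_inter_ball (h : IsC1BoundaryGraph Ω x e r γ) (hΩ : IsOpen Ω) :
    frontier Ω ∩ Metric.ball x r = range (graphMap e γ) ∩ Metric.ball x r := by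
  rw [hΩ.frontier_eq]
  ext y
  refine and_congr_left fun hy => ?_
  have h1 : y ∈ closure Ω ↔ y ∈ closedEpigraph e γ := by
    have := Set.ext_iff.1 h.closure_inter_ball y
    simpa [hy] using this
  rw [Set.mem_sdiff, h1, h.mem_iff y hy]
  constructor
  · rintro ⟨h2, h3⟩
    have h4 : γ ((ℝ ∙ e)ᗮ.orthogonalProjectionOnto y) = inner ℝ e y := le_antisymm h2 (not_lt.1 h3)
    exact ⟨(ℝ ∙ e)ᗮ.orthogonalProjectionOnto y, by
      rw [graphMap, h4, orthogonalProjectionOnto_add_inner_smul h.norm_direction]⟩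
  · rintro ⟨p, rfl⟩
    have h2 : (ℝ ∙ e)ᗮ.orthogonalProjectionOnto (graphMap e γ p) = p :=
      orthogonalProjectionOnto_add_smul e p _
    have h3 : inner ℝ e (graphMap e γ p) = γ p := inner_add_smul h.norm_direction p _
    simp [closedEpigraph, h2, h3]

theorem eq_inner_of_mem_frontier (h : IsC1BoundaryGraph Ω x e r γ) (hΩ : IsOpen Ω) {y : E}
    (hy : y ∈ Metric.ball x r) (hyΩ : y ∈ frontier Ω) :
    inner ℝ e y - γ ((ℝ ∙ e)ᗮ.orthogonalProjectionOnto y) = 0 := by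
  have h1 : y ∈ range (graphMap e γ) ∩ Metric.ball x r := h.frontier_inter_ball hΩ ▸ ⟨hyΩ, hy⟩
  obtain ⟨⟨p, rfl⟩, -⟩ := h1
  have h2 : (ℝ ∙ e)ᗮ.orthogonalProjectionOnto (graphMap e γ p) = p :=
    orthogonalProjectionOnto_add_smul e p _
  have h3 : inner ℝ e (graphMap e γ p) = γ p := inner_add_smul h.norm_direction p _
  rw [h2, h3, sub_self]

/-- The defining function ⟨e, ·⟩ - γ ∘ P vanishes at y and has gradient `upwardNormal`, so its sign
along a short ray is that of its directional derivative. The factor s, taken to be ±1 later, handles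
entering and leaving Ω together. -/
theorem eventually_sub_pos (h : IsC1BoundaryGraph Ω x e r γ) (hΩ : IsOpen Ω) {y : E}
    (hy : y ∈ Metric.ball x r) (hyΩ : y ∈ frontier Ω) {v : E} {s : ℝ}
    (hv : 0 < s * inner ℝ (upwardNormal e γ ((ℝ ∙ e)ᗮ.orthogonalProjectionOnto y)) v) :
    ∀ᶠ t in 𝓝[>] (0 : ℝ), y + t • v ∈ Metric.ball x r ∧ 0 < s * (inner ℝ e (y + t • v) -
      γ ((ℝ ∙ e)ᗮ.orthogonalProjectionOnto (y + t • v))) := by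
  have hlim : Tendsto (fun t : ℝ => y + t • v) (𝓝[>] 0) (𝓝 y) := by
    have := (show Continuous fun t : ℝ => y + t • v by fun_prop).tendsto 0
    simp only [zero_smul, add_zero] at this
    exact this.mono_left nhdsWithin_le_nhds
  refine Eventually.and (hlim (Metric.isOpen_ball.mem_nhds hy)) ?_
  have h0 := h.eq_inner_of_mem_frontier hΩ hy hyΩ
  have h1 := ((hasFDerivAt_inner_sub_comp_projection h.contDiff y).hasLineDerivAt v).const_mul s
  have h2 : HasDerivAt (fun t : ℝ => s * (inner ℝ e (y + t • v) -
      γ ((ℝ ∙ e)ᗮ.orthogonalProjectionOnto (y + t • v))))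
      (s * inner ℝ (upwardNormal e γ ((ℝ ∙ e)ᗮ.orthogonalProjectionOnto y)) v) 0 := h1
  have h3 := (hasDerivAt_iff_tendsto_slope_zero.1 h2).mono_left
    (nhdsWithin_mono 0 (fun t (ht : 0 < t) => ht.ne'))
  filter_upwards [h3.eventually (lt_mem_nhds hv), self_mem_nhdsWithin] with t ht ht0
  have ht0' : (0 : ℝ) < t := ht0
  simp only [zero_add, zero_smul, add_zero, h0, mul_zero, sub_zero, smul_eq_mul] at ht
  exact (mul_pos_iff_of_pos_left (inv_pos.2 ht0')).1 ht

theorem eventually_mem (h : IsC1BoundaryGraph Ω x e r γ) (hΩ : IsOpen Ω) {y : E}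
    (hy : y ∈ Metric.ball x r) (hyΩ : y ∈ frontier Ω) {v : E}
    (hv : 0 < inner ℝ (upwardNormal e γ ((ℝ ∙ e)ᗮ.orthogonalProjectionOnto y)) v) :
    ∀ᶠ t in 𝓝[>] (0 : ℝ), y + t • v ∈ Ω := by
  filter_upwards [h.eventually_sub_pos hΩ hy hyΩ (s := 1) (by simpa using hv)] with t ht
  refine (h.mem_iff _ ht.1).2 ?_
  linarith [ht.2]

theorem eventually_notMem (h : IsC1BoundaryGraph Ω x e r γ) (hΩ : IsOpen Ω) {y : E}
    (hy : y ∈ Metric.ball x r) (hyΩ : y ∈ frontier Ω) {v : E}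
    (hv : inner ℝ (upwardNormal e γ ((ℝ ∙ e)ᗮ.orthogonalProjectionOnto y)) v < 0) :
    ∀ᶠ t in 𝓝[>] (0 : ℝ), y + t • v ∉ Ω := by
  filter_upwards [h.eventually_sub_pos hΩ hy hyΩ (s := -1) (by simpa using hv)] with t ht
  rw [h.mem_iff _ ht.1, not_lt]
  linarith [ht.2]

/-- The unit outer normal can be computed in any graph representation of the boundary. -/
theorem eq_of_isUnitOuterNormal (h : IsC1BoundaryGraph Ω x e r γ) (hΩ : IsOpen Ω) {y w : E}
    (hy : y ∈ Metric.ball x r) (hw : IsUnitOuterNormal Ω y w) :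
    w = -(‖upwardNormal e γ ((ℝ ∙ e)ᗮ.orthogonalProjectionOnto y)‖⁻¹ •
      upwardNormal e γ ((ℝ ∙ e)ᗮ.orthogonalProjectionOnto y)) := by
  obtain ⟨hyΩ, e', r', γ', h', rfl⟩ := hw
  have hy' : y ∈ Metric.ball y r' := Metric.mem_ball_self h'.radius_pos
  rw [← norm_upwardNormal h'.norm_direction]
  set N := upwardNormal e γ ((ℝ ∙ e)ᗮ.orthogonalProjectionOnto y) with hN
  have hN' : ((gradient γ' ((ℝ ∙ e')ᗮ.orthogonalProjectionOnto y) : (ℝ ∙ e')ᗮ) : E) - e' =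
      -upwardNormal e' γ' ((ℝ ∙ e')ᗮ.orthogonalProjectionOnto y) := by simp [upwardNormal]
  rw [hN']
  set N' := upwardNormal e' γ' ((ℝ ∙ e')ᗮ.orthogonalProjectionOnto y) with hN'
  have hNpos : 0 < ‖N‖ := norm_upwardNormal_pos h.norm_direction _ _
  have hNpos' : 0 < ‖N'‖ := norm_upwardNormal_pos h'.norm_direction _ _
  rw [smul_neg, neg_inj]
  have hu : ‖‖N‖⁻¹ • N‖ = 1 := norm_smul_inv_norm (𝕜 := ℝ) (norm_pos_iff.1 hNpos)
  have hu' : ‖‖N'‖⁻¹ • N'‖ = 1 := norm_smul_inv_norm (𝕜 := ℝ) (norm_pos_iff.1 hNpos')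
  set m := ‖N‖⁻¹ • N with hm
  set m' := ‖N'‖⁻¹ • N' with hm'
  have hNm : N = ‖N‖ • m := by rw [hm, smul_smul, mul_inv_cancel₀ hNpos.ne', one_smul]
  have hNm' : N' = ‖N'‖ • m' := by rw [hm', smul_smul, mul_inv_cancel₀ hNpos'.ne', one_smul]
  -- Distinct unit normals m and m' satisfy ⟨m, m'⟩ < 1, so the direction m - m' points strictly
  -- into Ω according to one graph and strictly out of it according to the other.
  by_contra hne
  have hlt := (inner_lt_one_iff_real_of_norm_eq_one hu' hu).2 hne
  have h1 : 0 < inner ℝ N (m - m') := by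
    rw [hNm, real_inner_smul_left, inner_sub_right, real_inner_self_eq_norm_sq, hu,
      real_inner_comm]
    exact mul_pos hNpos (by linarith)
  have h2 : inner ℝ N' (m - m') < 0 := by
    rw [hNm', real_inner_smul_left, inner_sub_right, real_inner_self_eq_norm_sq, hu']
    exact mul_neg_of_pos_of_neg hNpos' (by linarith)
  obtain ⟨t, ht1, ht2⟩ :=
    ((h.eventually_mem hΩ hy hyΩ h1).and (h'.eventually_notMem hΩ hy' hyΩ h2)).exists
  exact ht2 ht1

end IsC1BoundaryGraph

/-- At a boundary point the tangent cone contains the open half-space of inward directions, which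
spans: v = (v + cN) - cN with c large. This makes derivatives within the closure unambiguous on ∂Ω.
-/
theorem IsC1Domain.uniqueDiffOn_closure {Ω : Set E} (hΩ : IsC1Domain Ω) :
    UniqueDiffOn ℝ (closure Ω) := by
  intro y hy
  by_cases hyΩ : y ∈ Ω
  · exact uniqueDiffWithinAt_of_mem_nhds
      (mem_of_superset (hΩ.isOpen.mem_nhds hyΩ) subset_closure)
  have hyf : y ∈ frontier Ω := by
    rw [hΩ.isOpen.frontier_eq]; exact ⟨hy, hyΩ⟩
  obtain ⟨e, r, γ, h⟩ := hΩ.boundary y hyf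
  have hyB : y ∈ Metric.ball y r := Metric.mem_ball_self h.radius_pos
  set N := upwardNormal e γ ((ℝ ∙ e)ᗮ.orthogonalProjectionOnto y) with hN
  have hNpos : 0 < ‖N‖ := norm_upwardNormal_pos h.norm_direction _ _
  have hcone : ∀ v, 0 < inner ℝ N v → v ∈ tangentConeAt ℝ (closure Ω) y := by
    intro v hv
    refine mem_tangentConeAt_of_add_smul_mem (l := 𝓝[>] (0 : ℝ)) (c := fun t => t) ?_ ?_
    · exact tendsto_nhdsWithin_mono_right (fun t (ht : 0 < t) => ht.ne') tendsto_id
    · filter_upwards [h.eventually_mem hΩ.isOpen hyB hyf hv] with t ht using subset_closure ht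
  rw [uniqueDiffWithinAt_iff]
  refine ⟨?_, subset_closure hy⟩
  have htop : Submodule.span ℝ (tangentConeAt ℝ (closure Ω) y) = ⊤ := by
    refine eq_top_iff.2 fun v _ => ?_
    have hNN : N ∈ Submodule.span ℝ (tangentConeAt ℝ (closure Ω) y) :=
      Submodule.subset_span (hcone N (by rw [real_inner_self_eq_norm_sq]; positivity))
    obtain ⟨c, hc⟩ : ∃ c : ℝ, 0 < inner ℝ N v + c * ‖N‖ ^ 2 :=
      ⟨(1 - inner ℝ N v) / ‖N‖ ^ 2, by field_simp; linarith⟩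
    have h1 : v + c • N ∈ Submodule.span ℝ (tangentConeAt ℝ (closure Ω) y) :=
      Submodule.subset_span (hcone _ (by
        rwa [inner_add_right, inner_smul_right, real_inner_self_eq_norm_sq]))
    have := Submodule.sub_mem _ h1 (Submodule.smul_mem _ c hNN)
    simpa using this
  rw [htop]
  exact dense_univ

end BoundaryGeometry

/-! ### Divergence theorem on bounded C¹ domains -/

section DivergenceTheorem

open Filter Topology Set
open scoped NNReal ENNReal

variable {E : Type*} [NormedAddCommGroup E] [InnerProductSpace ℝ E] [FiniteDimensional ℝ E]

theorem ContDiffOn.differentiableAt_of_mem_open_closure {F : Type*} [NormedAddCommGroup F]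
    [NormedSpace ℝ F] {Ω : Set F} (hΩ : IsOpen Ω)
    {f : F → ℝ} (hf : ContDiffOn ℝ 1 f (closure Ω)) {x : F} (hx : x ∈ Ω) :
    DifferentiableAt ℝ f x :=
  (hf.differentiableOn one_ne_zero).differentiableAt
    (mem_of_superset (hΩ.mem_nhds hx) subset_closure)

theorem fderivWithin_closure_eq_fderiv {F : Type*} [NormedAddCommGroup F] [NormedSpace ℝ F]
    {Ω : Set F} (hΩ : IsOpen Ω) (f : F → ℝ) {x : F} (hx : x ∈ Ω) :
    fderivWithin ℝ f (closure Ω) x = fderiv ℝ f x :=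
  fderivWithin_of_mem_nhds (mem_of_superset (hΩ.mem_nhds hx) subset_closure)

theorem IsC1Domain.continuousOn_fderivWithin_apply {Ω : Set E} (hΩ : IsC1Domain Ω) {f : E → ℝ}
    (hf : ContDiffOn ℝ 1 f (closure Ω)) (a : E) :
    ContinuousOn (fun x => fderivWithin ℝ f (closure Ω) x a) (closure Ω) :=
  (hf.continuousOn_fderivWithin hΩ.uniqueDiffOn_closure le_rfl).clm_apply continuousOn_const

/-- On the support of f the domain and the epigraph coincide locally, and off the support f vanishes
near each point. The derivative bound comes from compactness of the support intersected with the
closure of Ω. -/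
theorem IsC1Domain.isC1AboveGraph {Ω : Set E} (hΩ : IsC1Domain Ω) {x e : E} {r : ℝ}
    {γ : (ℝ ∙ e)ᗮ → ℝ} (h : IsC1BoundaryGraph Ω x e r γ) {f : E → ℝ}
    (hf : ContDiffOn ℝ 1 f (closure Ω)) (hc : HasCompactSupport f)
    (hsupp : tsupport f ⊆ Metric.ball x r) : IsC1AboveGraph e γ f where
  hasCompactSupport := hc
  contDiffOn := by
    intro z hz
    by_cases hzB : z ∈ tsupport f
    · have hzΩ : z ∈ Ω := (h.mem_iff z (hsupp hzB)).2 hz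
      exact (hf.contDiffAt (mem_of_superset (hΩ.isOpen.mem_nhds hzΩ)
        subset_closure)).contDiffWithinAt
    · exact ((contDiffAt_const (c := (0 : ℝ))).congr_of_eventuallyEq
        (notMem_tsupport_iff_eventuallyEq.1 hzB)).contDiffWithinAt
  continuousOn := by
    intro z hz
    by_cases hzB : z ∈ tsupport f
    · have hB := Metric.isOpen_ball.mem_nhds (hsupp hzB)
      have hzΩ : z ∈ closure Ω ∩ Metric.ball x r := h.closure_inter_ball ▸ ⟨hz, hsupp hzB⟩
      have h1 := (hf.continuousOn z hzΩ.1).mono (inter_subset_left (t := Metric.ball x r))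
      rw [h.closure_inter_ball] at h1
      exact (continuousWithinAt_inter hB).1 h1
    · exact (continuousAt_const.congr
        (notMem_tsupport_iff_eventuallyEq.1 hzB).symm).continuousWithinAt
  bounded := by
    have hcpt : IsCompact (tsupport f ∩ closure Ω) := hc.isCompact.inter_right isClosed_closure
    obtain ⟨C, hC⟩ := hcpt.exists_bound_of_continuousOn
      ((hf.continuousOn_fderivWithin hΩ.uniqueDiffOn_closure le_rfl).mono inter_subset_right)
    refine ⟨max C 0, fun z hz => ?_⟩
    by_cases hzB : z ∈ tsupport f
    · have hzΩ : z ∈ Ω := (h.mem_iff z (hsupp hzB)).2 hz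
      rw [← fderivWithin_closure_eq_fderiv hΩ.isOpen f hzΩ]
      exact (hC z ⟨hzB, subset_closure hzΩ⟩).trans (le_max_left _ _)
    · rw [fderiv_of_notMem_tsupport ℝ hzB, norm_zero]
      exact le_max_right _ _

variable [MeasurableSpace E] [BorelSpace E]

/-- The identity `∫_Ω ∂_a f = ∫_{∂Ω} f ⟨ν, a⟩` together with integrability of the integrands. -/
structure SatisfiesDivergenceThm (Ω : Set E) (ν : E → E) (f : E → ℝ) (a : E) : Prop where
  integrableOn : IntegrableOn (fun x => fderiv ℝ f x a) Ω
  integrableOn_frontier :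
    IntegrableOn (fun x => f x * inner ℝ (ν x) a) (frontier Ω) μHE[Module.finrank ℝ E - 1]
  integral_eq : ∫ x in Ω, fderiv ℝ f x a =
    ∫ x in frontier Ω, f x * inner ℝ (ν x) a ∂μHE[Module.finrank ℝ E - 1]

theorem IsC1Domain.integrableOn_fderiv_apply {Ω : Set E} (hΩ : IsC1Domain Ω)
    (hΩb : Bornology.IsBounded Ω) {f : E → ℝ} (hf : ContDiffOn ℝ 1 f (closure Ω)) (a : E) :
    IntegrableOn (fun x => fderiv ℝ f x a) Ω := by
  have h1 := (hΩ.continuousOn_fderivWithin_apply hf a).integrableOn_compact (μ := volume)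
    hΩb.isCompact_closure
  refine (h1.mono_set subset_closure).congr_fun (fun x hx => ?_) hΩ.isOpen.measurableSet
  simp only [fderivWithin_closure_eq_fderiv hΩ.isOpen f hx]

theorem IsC1Domain.satisfiesDivergenceThm_of_tsupport_subset {Ω : Set E} (hΩ : IsC1Domain Ω)
    (hΩb : Bornology.IsBounded Ω) (ν : E → E) {f : E → ℝ} (hf : ContDiffOn ℝ 1 f (closure Ω))
    (hsupp : tsupport f ⊆ Ω) (a : E) : SatisfiesDivergenceThm Ω ν f a := by
  have hc : HasCompactSupport f := hΩb.isCompact_closure.of_isClosed_subset (isClosed_tsupport f)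
    (hsupp.trans subset_closure)
  have hf' : ContDiff ℝ 1 f := by
    refine contDiff_iff_contDiffAt.2 fun x => ?_
    by_cases hx : x ∈ tsupport f
    · exact hf.contDiffAt (mem_of_superset (hΩ.isOpen.mem_nhds (hsupp hx)) subset_closure)
    · exact (contDiffAt_const (c := (0 : ℝ))).congr_of_eventuallyEq
        (notMem_tsupport_iff_eventuallyEq.1 hx)
  have h0 : ∀ x ∈ frontier Ω, f x = 0 := fun x hx => image_eq_zero_of_notMem_tsupport fun h =>
    (hΩ.isOpen.frontier_eq ▸ hx).2 (hsupp h)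
  have h0' : ∀ x ∈ frontier Ω, f x * inner ℝ (ν x) a = 0 := fun x hx => by rw [h0 x hx, zero_mul]
  have hm : MeasurableSet (frontier Ω) := isClosed_frontier.measurableSet
  refine ⟨hΩ.integrableOn_fderiv_apply hΩb hf a, ?_, ?_⟩
  · exact (integrableOn_congr_fun (g := fun _ => (0 : ℝ)) h0' hm).2 integrableOn_zero
  · rw [setIntegral_congr_fun hm (g := fun _ => (0 : ℝ)) h0', integral_zero,
      setIntegral_eq_integral_of_forall_compl_eq_zero,
      integral_fderiv_eq_zero_of_hasCompactSupport hf' hc]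
    intro x hx
    rw [fderiv_of_notMem_tsupport ℝ fun h => hx (hsupp h)]
    simp

theorem IsC1Domain.satisfiesDivergenceThm_of_tsupport_subset_ball {Ω : Set E}
    (hΩ : IsC1Domain Ω) (hΩb : Bornology.IsBounded Ω) {ν : E → E}
    (hν : ∀ x ∈ frontier Ω, IsUnitOuterNormal Ω x (ν x)) {x e : E} {r : ℝ} {γ : (ℝ ∙ e)ᗮ → ℝ}
    (h : IsC1BoundaryGraph Ω x e r γ) {f : E → ℝ} (hf : ContDiffOn ℝ 1 f (closure Ω))
    (hc : HasCompactSupport f) (hsupp : tsupport f ⊆ Metric.ball x r) (a : E) :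
    SatisfiesDivergenceThm Ω ν f a := by
  have hg := hΩ.isC1AboveGraph h hf hc hsupp
  have he := h.norm_direction
  have hγ := h.contDiff
  have hfz : ∀ z, z ∉ Metric.ball x r → f z = 0 := fun z hz =>
    image_eq_zero_of_notMem_tsupport fun h => hz (hsupp h)
  have hfz' : ∀ z, z ∉ Metric.ball x r → fderiv ℝ f z a = 0 := fun z hz => by
    rw [fderiv_of_notMem_tsupport ℝ fun h => hz (hsupp h)]; simp
  have hm : MeasurableSet (frontier Ω) := isClosed_frontier.measurableSet
  have hmG : MeasurableSet (range (graphMap e γ)) :=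
    (measurableEmbedding_graphMap he hγ.continuous).measurableSet_range
  have hint : ∫ z in Ω, fderiv ℝ f z a = ∫ z in strictEpigraph e γ, fderiv ℝ f z a := by
    rw [setIntegral_eq_of_subset_of_forall_sdiff_eq_zero (s := Ω ∩ Metric.ball x r)
        hΩ.isOpen.measurableSet inter_subset_left fun z hz => hfz' z fun hB => hz.2 ⟨hz.1, hB⟩,
      setIntegral_eq_of_subset_of_forall_sdiff_eq_zero (s := strictEpigraph e γ ∩ Metric.ball x r)
        (isOpen_strictEpigraph hγ.continuous).measurableSet inter_subset_left
        fun z hz => hfz' z fun hB => hz.2 ⟨hz.1, hB⟩, h.inter_ball]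
  -- The surface density √(1 + |∇γ|²) is exactly the normalizing factor of ν, so density times ν is
  -- ∇γ - e. Outside the ball both sides vanish with f.
  have hpt : ∀ y, √(1 + ‖gradient γ y‖ ^ 2) *
      (f (graphMap e γ y) * inner ℝ (ν (graphMap e γ y)) a) =
      f (graphMap e γ y) * inner ℝ (((gradient γ y : (ℝ ∙ e)ᗮ) : E) - e) a := by
    intro y
    by_cases hB : graphMap e γ y ∈ Metric.ball x r
    · have hfr : graphMap e γ y ∈ frontier Ω ∩ Metric.ball x r :=
        h.frontier_inter_ball hΩ.isOpen ▸ ⟨mem_range_self y, hB⟩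
      have hP : (ℝ ∙ e)ᗮ.orthogonalProjectionOnto (graphMap e γ y) = y :=
        orthogonalProjectionOnto_add_smul e y _
      have h1 := h.eq_of_isUnitOuterNormal hΩ.isOpen hB (hν _ hfr.1)
      rw [hP] at h1
      have hpos := norm_upwardNormal_pos he γ y
      rw [h1, ← norm_upwardNormal he, inner_neg_left, real_inner_smul_left,
        ← neg_sub e, inner_neg_left, upwardNormal] at *
      field_simp
    · simp [hfz _ hB]
  have hfG : Continuous fun y => f (graphMap e γ y) := by
    refine hg.continuousOn.comp_continuous (continuous_graphMap hγ.continuous) fun y => ?_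
    rw [← graphChart_zero]
    exact (graphChart_mem_closedEpigraph he).2 le_rfl
  have hfGc : HasCompactSupport fun y => f (graphMap e γ y) := by
    simpa only [graphChart_zero] using hg.hasCompactSupport_graphChart 0
  have hgr := continuous_gradient hγ
  have hintG : IntegrableOn (fun z => f z * inner ℝ (ν z) a) (range (graphMap e γ))
      μHE[Module.finrank ℝ E - 1] := by
    rw [integrableOn_range_graphMap_iff he hγ]
    simp_rw [hpt]
    refine Continuous.integrable_of_hasCompactSupport (hfG.mul ?_) hfGc.mul_right
    exact ((continuous_subtype_val.comp hgr).sub continuous_const).inner continuous_const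
  have hz1 : ∀ S : Set E, ∀ z ∈ S \ (S ∩ Metric.ball x r), f z * inner ℝ (ν z) a = 0 :=
    fun S z hz => by rw [hfz z fun hB => hz.2 ⟨hz.1, hB⟩, zero_mul]
  refine ⟨hΩ.integrableOn_fderiv_apply hΩb hf a, ?_, ?_⟩
  · have h1 : IntegrableOn (fun z => f z * inner ℝ (ν z) a) (frontier Ω ∩ Metric.ball x r)
        μHE[Module.finrank ℝ E - 1] := by
      rw [h.frontier_inter_ball hΩ.isOpen]
      exact hintG.mono_set inter_subset_left
    exact h1.of_forall_sdiff_eq_zero hm (hz1 _)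
  · rw [hint, hg.setIntegral_fderiv he hγ,
      setIntegral_eq_of_subset_of_forall_sdiff_eq_zero hm inter_subset_left (hz1 (frontier Ω)),
      h.frontier_inter_ball hΩ.isOpen,
      ← setIntegral_eq_of_subset_of_forall_sdiff_eq_zero hmG inter_subset_left (hz1 _),
      setIntegral_range_graphMap he hγ]
    simp_rw [hpt]

theorem SatisfiesDivergenceThm.congr {Ω : Set E} {ν : E → E} {f g : E → ℝ} {a : E}
    (hf : SatisfiesDivergenceThm Ω ν f a) (hΩ : IsOpen Ω) (h : EqOn g f (closure Ω)) :
    SatisfiesDivergenceThm Ω ν g a := by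
  have h1 : EqOn (fun x => fderiv ℝ g x a) (fun x => fderiv ℝ f x a) Ω := fun x hx => by
    have : g =ᶠ[𝓝 x] f := by
      filter_upwards [hΩ.mem_nhds hx] with y hy using h (subset_closure hy)
    simp only [this.fderiv_eq]
  have h2 : EqOn (fun x => g x * inner ℝ (ν x) a) (fun x => f x * inner ℝ (ν x) a)
      (frontier Ω) := fun x hx => by
    simp only [h (frontier_subset_closure hx)]
  have hm : MeasurableSet (frontier Ω) := isClosed_frontier.measurableSet
  exact ⟨(integrableOn_congr_fun h1 hΩ.measurableSet).2 hf.integrableOn,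
    (integrableOn_congr_fun h2 hm).2 hf.integrableOn_frontier, by
      rw [setIntegral_congr_fun hΩ.measurableSet h1, setIntegral_congr_fun hm h2, hf.integral_eq]⟩

theorem SatisfiesDivergenceThm.sum {ι : Type*} {Ω : Set E} {ν : E → E} {f : ι → E → ℝ} {a : E}
    {t : Finset ι} (hΩ : IsOpen Ω) (hd : ∀ i ∈ t, ∀ x ∈ Ω, DifferentiableAt ℝ (f i) x)
    (hf : ∀ i ∈ t, SatisfiesDivergenceThm Ω ν (f i) a) :
    SatisfiesDivergenceThm Ω ν (fun x => ∑ i ∈ t, f i x) a := by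
  have h1 : EqOn (fun x => fderiv ℝ (fun x => ∑ i ∈ t, f i x) x a)
      (fun x => ∑ i ∈ t, fderiv ℝ (f i) x a) Ω := fun x hx => by
    simp only
    rw [fderiv_fun_sum fun i hi => hd i hi x hx]
    simp
  refine ⟨(integrableOn_congr_fun h1 hΩ.measurableSet).2
    (integrable_finsetSum _ fun i hi => (hf i hi).integrableOn), ?_, ?_⟩
  · simp_rw [Finset.sum_mul]
    exact integrable_finsetSum _ fun i hi => (hf i hi).integrableOn_frontier
  · rw [setIntegral_congr_fun hΩ.measurableSet h1,
      integral_finsetSum _ fun i hi => (hf i hi).integrableOn]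
    simp_rw [Finset.sum_mul]
    rw [integral_finsetSum _ fun i hi => (hf i hi).integrableOn_frontier]
    exact Finset.sum_congr rfl fun i hi => (hf i hi).integral_eq

/-- The **divergence theorem** on a bounded domain with `C¹` boundary. -/
theorem IsC1Domain.satisfiesDivergenceThm {Ω : Set E} (hΩ : IsC1Domain Ω)
    (hΩb : Bornology.IsBounded Ω) {ν : E → E}
    (hν : ∀ x ∈ frontier Ω, IsUnitOuterNormal Ω x (ν x)) {f : E → ℝ}
    (hf : ContDiffOn ℝ 1 f (closure Ω)) (a : E) : SatisfiesDivergenceThm Ω ν f a := by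
  have hloc : ∀ x, ∃ b : ContDiffBump x, x ∈ closure Ω → ∀ g : E → ℝ,
      ContDiffOn ℝ 1 g (closure Ω) → SatisfiesDivergenceThm Ω ν (fun y => b y * g y) a := by
    intro x
    have hbump : ∀ r > 0, ∃ b : ContDiffBump x, tsupport b ⊆ Metric.ball x r := fun r hr =>
      ⟨⟨r / 4, r / 2, by positivity, by linarith⟩, by
        rw [ContDiffBump.tsupport_eq]
        exact Metric.closedBall_subset_ball (by simp only; linarith)⟩
    by_cases hx : x ∈ closure Ω
    swap
    · exact ⟨(hbump 1 one_pos).choose, fun h => absurd h hx⟩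
    by_cases hxΩ : x ∈ Ω
    · obtain ⟨r, hr, hrΩ⟩ := Metric.isOpen_iff.1 hΩ.isOpen x hxΩ
      obtain ⟨b, hb⟩ := hbump r hr
      refine ⟨b, fun _ g hg => ?_⟩
      exact hΩ.satisfiesDivergenceThm_of_tsupport_subset hΩb ν (b.contDiff.contDiffOn.mul hg)
        ((tsupport_mul_subset_left).trans (hb.trans hrΩ)) a
    · obtain ⟨e, r, γ, h⟩ := hΩ.boundary x (hΩ.isOpen.frontier_eq ▸ ⟨hx, hxΩ⟩)
      obtain ⟨b, hb⟩ := hbump r h.radius_pos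
      refine ⟨b, fun _ g hg => ?_⟩
      exact hΩ.satisfiesDivergenceThm_of_tsupport_subset_ball hΩb hν h
        (b.contDiff.contDiffOn.mul hg) b.hasCompactSupport.mul_right
        ((tsupport_mul_subset_left).trans hb) a
  choose b hb using hloc
  obtain ⟨t, ht, hcov⟩ := hΩb.isCompact_closure.elim_nhds_subcover
    (fun x => Metric.ball x (b x).rIn) fun x _ => Metric.ball_mem_nhds x (b x).rIn_pos
  -- Ψ is positive on the closure of Ω, so the functions b x / Ψ sum to 1 there. The behaviour of f
  -- / Ψ elsewhere is irrelevant, because the identity depends only on values on the closure.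
  set Ψ : E → ℝ := fun y => ∑ x ∈ t, b x y with hΨ
  have hΨc : ContDiff ℝ 1 Ψ := ContDiff.sum fun x _ => (b x).contDiff
  have hΨpos : ∀ y ∈ closure Ω, 0 < Ψ y := fun y hy => by
    obtain ⟨x, hx, hxy⟩ := mem_iUnion₂.1 (hcov hy)
    refine Finset.sum_pos' (fun i _ => (b i).nonneg) ⟨x, hx, ?_⟩
    rw [(b x).one_of_mem_closedBall (Metric.ball_subset_closedBall hxy)]
    exact one_pos
  have hg : ContDiffOn ℝ 1 (fun y => f y / Ψ y) (closure Ω) :=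
    hf.div hΨc.contDiffOn fun y hy => (hΨpos y hy).ne'
  have hsum := SatisfiesDivergenceThm.sum (t := t) (f := fun x y => b x y * (f y / Ψ y)) hΩ.isOpen
    (fun x _ y hy => ((b x).contDiff.contDiffOn.mul hg).differentiableAt_of_mem_open_closure
      hΩ.isOpen hy) fun x hx => hb x (ht x hx) _ hg
  refine hsum.congr hΩ.isOpen fun y hy => ?_
  have := (hΨpos y hy).ne'
  simp only
  rw [← Finset.sum_mul]
  change f y = Ψ y * (f y / Ψ y)
  field_simp

end DivergenceTheorem

/-! ### Weakly divergence-free derivatives; gradients on zero sets -/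

section WeaklyHarmonic

open Filter Topology Set
open scoped NNReal ENNReal

variable {E : Type*} [NormedAddCommGroup E] [NormedSpace ℝ E] [FiniteDimensional ℝ E]

omit [FiniteDimensional ℝ E] in
theorem ContDiff.continuous_fderiv_apply_const {p : E → ℝ} (hp : ContDiff ℝ 1 p) (a : E) :
    Continuous fun x => fderiv ℝ p x a :=
  (hp.continuous_fderiv one_ne_zero).clm_apply continuous_const

theorem exists_contDiff_one_nhds_of_isCompact_subset {K Ω : Set E} (hK : IsCompact K)
    (hΩ : IsOpen Ω) (hKΩ : K ⊆ Ω) :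
    ∃ χ : E → ℝ, ContDiff ℝ 1 χ ∧ HasCompactSupport χ ∧ tsupport χ ⊆ Ω ∧
      ∀ x ∈ K, χ =ᶠ[𝓝 x] 1 := by
  obtain ⟨L, hL, hKL, hLΩ⟩ := exists_compact_between hK hΩ hKΩ
  obtain ⟨f, hf1, hf0, -⟩ := exists_contMDiffMap_one_nhds_of_subset_interior (n := 1)
    (modelWithCornersSelf ℝ E) hK.isClosed hKL
  have hsupp : tsupport f ⊆ L := closure_minimal (fun x hx => by
    by_contra h
    exact hx (hf0 x h)) hL.isClosed
  refine ⟨f, f.contMDiff.contDiff, hL.of_isClosed_subset (isClosed_tsupport _) hsupp,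
    hsupp.trans hLΩ, fun x hx => ?_⟩
  exact (eventually_nhdsSet_iff_forall.1 hf1) x hx

variable [MeasurableSpace E] [BorelSpace E] {μ : Measure E} [μ.IsAddHaarMeasure]

omit [FiniteDimensional ℝ E] in
theorem hasDerivAt_integral_translate_mul {p g : E → ℝ} (hp : ContDiff ℝ 1 p)
    (hpc : HasCompactSupport p) (hg : Continuous g) (hgc : HasCompactSupport g) (a : E) :
    HasDerivAt (fun s : ℝ => ∫ x, p (x + s • a) * g x ∂μ) (∫ x, fderiv ℝ p x a * g x ∂μ) 0 := by
  have hp' := hp.continuous_fderiv_apply_const a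
  obtain ⟨C, hC⟩ := hp'.bounded_above_of_compact_support (hpc.fderiv_apply ℝ a)
  have hpcont := hp.continuous
  have h := hasDerivAt_integral_of_dominated_loc_of_deriv_le (μ := μ) (s := univ) (x₀ := (0 : ℝ))
    (F := fun s x => p (x + s • a) * g x) (F' := fun s x => fderiv ℝ p (x + s • a) a * g x)
    (bound := fun x => C * ‖g x‖) univ_mem
    (Eventually.of_forall fun s => Continuous.aestronglyMeasurable (by fun_prop))
    (Continuous.integrable_of_hasCompactSupport (by fun_prop) hgc.mul_left)
    (Continuous.aestronglyMeasurable ((hp'.comp (by fun_prop)).mul hg))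
    (ae_of_all _ fun x s _ => by
      rw [norm_mul]
      gcongr
      exact hC _)
    (Continuous.integrable_of_hasCompactSupport (by fun_prop) hgc.norm.mul_left)
    (ae_of_all _ fun x s _ => by
      have h1 : HasDerivAt (fun s : ℝ => x + s • a) a s := by
        simpa using ((hasDerivAt_id s).smul_const a).const_add x
      exact ((hp.differentiable one_ne_zero _).hasFDerivAt.comp_hasDerivAt s h1).mul_const _)
  simpa using h.2

theorem integral_mul_fderiv_eq_neg {f g : E → ℝ} (hf : ContDiff ℝ 1 f) (hg : ContDiff ℝ 1 g)
    (hgc : HasCompactSupport g) (b : E) :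
    ∫ x, f x * fderiv ℝ g x b ∂μ = - ∫ x, fderiv ℝ f x b * g x ∂μ := by
  have hf' := hf.continuous_fderiv_apply_const b
  have hg' := hg.continuous_fderiv_apply_const b
  exact integral_mul_fderiv_eq_neg_fderiv_mul_of_integrable (𝕜 := ℝ)
    ((hf'.mul hg.continuous).integrable_of_hasCompactSupport hgc.mul_left)
    ((hf.continuous.mul hg').integrable_of_hasCompactSupport (hgc.fderiv_apply ℝ b).mul_left)
    ((hf.continuous.mul hg.continuous).integrable_of_hasCompactSupport hgc.mul_left)
    (fun x _ => hf.differentiable one_ne_zero x) (fun x _ => hg.differentiable one_ne_zero x)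

/-- No second derivatives are available, so one of the two derivatives is replaced by a translation.
Integrating by parts in direction b and changing variables gives ∫ p(x + sa) ∂_bφ(x) = -∫ φ(x - sa)
∂_b p(x); differentiating at s = 0 gives the claim. -/
theorem integral_fderiv_mul_fderiv_comm {p φ : E → ℝ} (hp : ContDiff ℝ 1 p)
    (hpc : HasCompactSupport p) (hφ : ContDiff ℝ 1 φ) (hφc : HasCompactSupport φ) (a b : E) :
    ∫ x, fderiv ℝ p x a * fderiv ℝ φ x b ∂μ = ∫ x, fderiv ℝ p x b * fderiv ℝ φ x a ∂μ := by
  have h1 := hasDerivAt_integral_translate_mul (μ := μ) hp hpc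
    (hφ.continuous_fderiv_apply_const b) (hφc.fderiv_apply ℝ b) a
  have h2 := (hasDerivAt_integral_translate_mul (μ := μ) hφ hφc
    (hp.continuous_fderiv_apply_const b) (hpc.fderiv_apply ℝ b) (-a)).neg
  have h3 : (fun s : ℝ => ∫ x, p (x + s • a) * fderiv ℝ φ x b ∂μ) =
      -fun s : ℝ => ∫ x, φ (x + s • -a) * fderiv ℝ p x b ∂μ := by
    ext s
    have hps : ContDiff ℝ 1 fun x => p (x + s • a) := hp.comp (by fun_prop)
    rw [integral_mul_fderiv_eq_neg hps hφ hφc]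
    simp only [Pi.neg_apply, neg_inj, fderiv_comp_add_right]
    rw [← integral_add_right_eq_self (fun x => φ (x + s • -a) * fderiv ℝ p x b) (s • a)]
    refine integral_congr_ae (ae_of_all _ fun x => ?_)
    simp [mul_comm]
  rw [h3] at h1
  rw [h1.unique h2, ← integral_neg]
  refine integral_congr_ae (ae_of_all _ fun x => ?_)
  simp [mul_comm]

/-- Any directional derivative of a divergence-free `C¹` field is weakly divergence-free. -/
theorem setIntegral_sum_fderiv_mul_fderiv_eq_zero {ι : Type*} [Fintype ι] {Ω : Set E}
    (hΩ : IsOpen Ω) {e : ι → E} {p : ι → E → ℝ} (hp : ∀ i, ContDiffOn ℝ 1 (p i) Ω)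
    (hdiv : ∀ x ∈ Ω, ∑ i, fderiv ℝ (p i) x (e i) = 0) {φ : E → ℝ} (hφ : ContDiff ℝ 1 φ)
    (hφc : HasCompactSupport φ) (hφΩ : tsupport φ ⊆ Ω) (a : E) :
    ∫ x in Ω, ∑ i, fderiv ℝ (p i) x a * fderiv ℝ φ x (e i) ∂μ = 0 := by
  -- Since χ = 1 near the support of φ, the fields χ pᵢ are globally C¹ with compact support and
  -- have the same derivatives as pᵢ wherever the derivatives of φ are nonzero.
  obtain ⟨χ, hχ, hχc, hχΩ, hχ1⟩ := exists_contDiff_one_nhds_of_isCompact_subset hφc.isCompact hΩ hφΩ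
  have hP : ∀ i, ContDiff ℝ 1 fun x => χ x * p i x := fun i => by
    refine contDiff_iff_contDiffAt.2 fun x => ?_
    by_cases hx : x ∈ tsupport χ
    · exact hχ.contDiffAt.mul ((hp i).contDiffAt (hΩ.mem_nhds (hχΩ hx)))
    · refine (contDiffAt_const (c := (0 : ℝ))).congr_of_eventuallyEq ?_
      filter_upwards [notMem_tsupport_iff_eventuallyEq.1 hx] with y hy
      rw [hy]; simp
  have hPc : ∀ i, HasCompactSupport fun x => χ x * p i x := fun i => hχc.mul_right
  have hPp : ∀ i, ∀ x ∈ tsupport φ, fderiv ℝ (fun x => χ x * p i x) x = fderiv ℝ (p i) x :=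
    fun i x hx => by
      refine Filter.EventuallyEq.fderiv_eq ?_
      filter_upwards [hχ1 x hx] with y hy
      rw [hy]; simp
  have hφ0 : ∀ x, x ∉ tsupport φ → ∀ b, fderiv ℝ φ x b = 0 := fun x hx b => by
    rw [fderiv_of_notMem_tsupport ℝ hx]; simp
  have hint : ∀ i, ∀ b c : E, Integrable
      (fun x => fderiv ℝ (fun x => χ x * p i x) x b * fderiv ℝ φ x c) μ := fun i b c =>
    (((hP i).continuous_fderiv_apply_const b).mul
      (hφ.continuous_fderiv_apply_const c)).integrable_of_hasCompactSupport
      (hφc.fderiv_apply ℝ c).mul_left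
  calc ∫ x in Ω, ∑ i, fderiv ℝ (p i) x a * fderiv ℝ φ x (e i) ∂μ
      = ∫ x, ∑ i, fderiv ℝ (p i) x a * fderiv ℝ φ x (e i) ∂μ := by
        refine setIntegral_eq_integral_of_forall_compl_eq_zero fun x hx => ?_
        exact Finset.sum_eq_zero fun i _ => by rw [hφ0 x fun h => hx (hφΩ h), mul_zero]
    _ = ∫ x, ∑ i, fderiv ℝ (fun x => χ x * p i x) x a * fderiv ℝ φ x (e i) ∂μ := by
        refine integral_congr_ae (ae_of_all _ fun x => Finset.sum_congr rfl fun i _ => ?_)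
        by_cases hx : x ∈ tsupport φ
        · rw [hPp i x hx]
        · simp only [hφ0 x hx, mul_zero]
    _ = ∑ i, ∫ x, fderiv ℝ (fun x => χ x * p i x) x (e i) * fderiv ℝ φ x a ∂μ := by
        rw [integral_finsetSum _ fun i _ => hint i _ _]
        exact Finset.sum_congr rfl fun i _ =>
          integral_fderiv_mul_fderiv_comm (hP i) (hPc i) hφ hφc _ _
    _ = ∫ x, ∑ i, fderiv ℝ (fun x => χ x * p i x) x (e i) * fderiv ℝ φ x a ∂μ := by
        rw [integral_finsetSum _ fun i _ => hint i _ _]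
    _ = ∫ x, 0 ∂μ := by
        refine integral_congr_ae (ae_of_all _ fun x => ?_)
        simp only
        by_cases hx : x ∈ tsupport φ
        · rw [← Finset.sum_mul]
          simp_rw [hPp _ x hx]
          rw [hdiv x (hφΩ hx), zero_mul]
        · simp only [hφ0 x hx, mul_zero, Finset.sum_const_zero]
    _ = 0 := integral_zero _ _

/-- A zero with nonzero derivative is isolated among zeros, so S is discrete; a discrete subset of
the line is countable. -/
theorem countable_setOf_eq_zero_and_hasDerivAt_ne_zero {g g' : ℝ → ℝ} {S : Set ℝ}
    (hg : ∀ t ∈ S, g t = 0 ∧ g' t ≠ 0 ∧ HasDerivAt g (g' t) t) : S.Countable := by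
  have hd : DiscreteTopology S := by
    rw [discreteTopology_subtype_iff]
    intro t ht
    rw [← disjoint_iff, disjoint_principal_right]
    filter_upwards [(hg t ht).2.2.eventually_ne (c := 0) (hg t ht).2.1] with s hs hsS
    exact hs (hg s hsS).1
  exact countable_coe_iff.1 (countable_of_Lindelof_of_discrete (X := S))

/-- The gradient of a differentiable function vanishes almost everywhere on its zero set. -/
theorem ae_fderiv_apply_eq_zero_of_eq_zero {Ω : Set E} (hΩ : IsOpen Ω) {f : E → ℝ}
    (hf : DifferentiableOn ℝ f Ω) (a : E) :
    ∀ᵐ x ∂μ, x ∈ Ω → f x = 0 → fderiv ℝ f x a = 0 := by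
  let s : Set E := {x | x ∈ Ω → f x = 0 → fderiv ℝ f x a = 0}
  have hs : MeasurableSet s := by
    obtain ⟨u, hu, huΩ⟩ := continuousOn_iff_isClosed.1 hf.continuousOn {0} isClosed_singleton
    have : s = ((u ∩ Ω) ∩ {x | fderiv ℝ f x a ≠ 0})ᶜ := by
      rw [← huΩ]
      ext x
      simp only [s, mem_ofPred_eq, mem_compl_iff, mem_inter_iff, mem_preimage, mem_singleton_iff]
      tauto
    rw [this]
    exact ((hu.measurableSet.inter hΩ.measurableSet).inter
      ((measurable_fderiv_apply_const ℝ f a) (measurableSet_singleton 0).compl)).compl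
  -- Fubini along lines parallel to a: each line meets the exceptional set in countably many
  -- parameters, a null set.
  have key := ae_mem_of_ae_add_linearMap_mem (LinearMap.toSpanSingleton ℝ E a) volume μ hs
    fun y => by
      have hc : {t : ℝ | y + LinearMap.toSpanSingleton ℝ E a t ∉ s}.Countable := by
        refine countable_setOf_eq_zero_and_hasDerivAt_ne_zero (g := fun t => f (y + t • a))
          (g' := fun t => fderiv ℝ f (y + t • a) a) fun t ht => ?_
        simp only [s, mem_ofPred_eq, LinearMap.toSpanSingleton_apply, not_forall] at ht
        obtain ⟨h1, h2, h3⟩ := ht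
        refine ⟨h2, h3, ?_⟩
        have h4 : HasDerivAt (fun t : ℝ => y + t • a) a t := by
          simpa using ((hasDerivAt_id t).smul_const a).const_add y
        exact (hf.differentiableAt (hΩ.mem_nhds h1)).hasFDerivAt.comp_hasDerivAt t h4
      exact ae_iff.2 (hc.measure_zero volume)
  exact key

end WeaklyHarmonic

/-! ### Test functions with zero boundary values -/

section ZeroBoundaryValues

open Filter Topology Set
open scoped NNReal ENNReal

/-- The rescalings η(kt)/k vanish near 0 and have uniformly bounded derivatives equal to 1 for |t| ≥
2/k. Composed with a function vanishing on ∂Ω, they give compactly supported approximations. -/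
theorem exists_contDiff_truncation : ∃ η : ℝ → ℝ, ContDiff ℝ 1 η ∧ (∀ t, |t| ≤ 1 → η t = 0) ∧
    deriv η 0 = 0 ∧ (∀ t, 2 ≤ |t| → deriv η t = 1) ∧ ∃ M, ∀ t, |deriv η t| ≤ M := by
  let η : ℝ → ℝ := fun t => t * Real.smoothTransition (t ^ 2 - 1)
  have hη : ContDiff ℝ 1 η :=
    contDiff_id.mul (Real.smoothTransition.contDiff.comp (by fun_prop))
  have h0 : ∀ t, |t| ≤ 1 → η t = 0 := fun t ht => by
    have : t ^ 2 - 1 ≤ 0 := by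
      rw [← sq_abs]; nlinarith [abs_nonneg t]
    simp only [η, Real.smoothTransition.zero_of_nonpos this, mul_zero]
  have h1 : ∀ t, 2 ≤ |t| → deriv η t = 1 := fun t ht => by
    have : η =ᶠ[𝓝 t] id := by
      have hnear : ∀ᶠ y in 𝓝 t, 2 < y ^ 2 :=
        (continuous_pow 2).continuousAt.eventually (lt_mem_nhds (by
          simp only; rw [← sq_abs]; nlinarith))
      filter_upwards [hnear] with y hy
      simp only [η, Real.smoothTransition.one_of_one_le (show 1 ≤ y ^ 2 - 1 by linarith), mul_one,
        id]
    rw [this.deriv_eq, deriv_id]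
  refine ⟨η, hη, h0, ?_, h1, ?_⟩
  · have : η =ᶠ[𝓝 0] fun _ => 0 := by
      filter_upwards [Metric.closedBall_mem_nhds (0 : ℝ) one_pos] with y hy
      exact h0 y (by simpa using hy)
    rw [this.deriv_eq, deriv_const]
  · obtain ⟨C, hC⟩ := (isCompact_Icc (a := (-2 : ℝ)) (b := 2)).exists_bound_of_continuousOn
      (hη.continuous_deriv le_rfl).continuousOn
    refine ⟨max C 1, fun t => ?_⟩
    by_cases ht : |t| ≤ 2
    · exact (hC t (abs_le.1 ht)).trans (le_max_left _ _)
    · rw [h1 t (not_le.1 ht).le, abs_one]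
      exact le_max_right _ _

variable {E : Type*} [NormedAddCommGroup E] [InnerProductSpace ℝ E] [FiniteDimensional ℝ E]
  [MeasurableSpace E] [BorelSpace E]

theorem integrableOn_of_continuousOn_closure {Ω : Set E} (hΩb : Bornology.IsBounded Ω)
    {g : E → ℝ} (hg : ContinuousOn g (closure Ω)) : IntegrableOn g Ω :=
  (hg.integrableOn_compact hΩb.isCompact_closure).mono_set subset_closure

/-- A weakly divergence-free field is orthogonal to the gradient of every function which is `C¹` up
to the boundary and vanishes there. -/
theorem IsC1Domain.setIntegral_sum_mul_fderivWithin_eq_zero {ι : Type*} [Fintype ι] {Ω : Set E}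
    (hΩ : IsC1Domain Ω) (hΩb : Bornology.IsBounded Ω) {e : ι → E} {W : ι → E → ℝ}
    (hWc : ∀ i, ContinuousOn (W i) (closure Ω))
    (hW : ∀ φ : E → ℝ, ContDiff ℝ 1 φ → HasCompactSupport φ → tsupport φ ⊆ Ω →
      ∫ x in Ω, ∑ i, W i x * fderiv ℝ φ x (e i) = 0)
    {f : E → ℝ} (hf : ContDiffOn ℝ 1 f (closure Ω)) (hf0 : ∀ x ∈ frontier Ω, f x = 0) :
    ∫ x in Ω, ∑ i, W i x * fderivWithin ℝ f (closure Ω) x (e i) = 0 := by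
  obtain ⟨η, hη, hη0, hη'0, hη1, M, hM⟩ := exists_contDiff_truncation
  have hΩm := hΩ.isOpen.measurableSet
  set G : E → ℝ := fun x => ∑ i, W i x * fderivWithin ℝ f (closure Ω) x (e i) with hG
  have hGc : ContinuousOn G (closure Ω) := continuousOn_finsetSum _ fun i _ =>
    (hWc i).mul (hΩ.continuousOn_fderivWithin_apply hf (e i))
  have hη'c : Continuous (deriv η) := hη.continuous_deriv le_rfl
  have hzero : ∀ k : ℕ, ∫ x in Ω, deriv η ((k + 1 : ℝ) * f x) * G x = 0 := by
    intro k
    have hk : (0 : ℝ) < k + 1 := by positivity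
    set φ : E → ℝ := Ω.indicator fun x => η ((k + 1 : ℝ) * f x) / (k + 1) with hφ
    -- S contains the support of the truncation φ and avoids ∂Ω, where f = 0; being closed in the
    -- compact closure of Ω, it makes φ a legitimate test function.
    set S : Set E := closure Ω ∩ f ⁻¹' {t | 1 ≤ |(k + 1 : ℝ) * t|} with hS
    have hSc : IsClosed S := hf.continuousOn.preimage_isClosed_of_isClosed isClosed_closure
      (isClosed_le continuous_const (by fun_prop))
    have hSΩ : S ⊆ Ω := fun x hx => by
      by_contra hxΩ
      have := hf0 x (hΩ.isOpen.frontier_eq ▸ ⟨hx.1, hxΩ⟩)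
      have h2 : 1 ≤ |(k + 1 : ℝ) * f x| := hx.2
      rw [this, mul_zero, abs_zero] at h2
      linarith
    have hsupp : tsupport φ ⊆ S := by
      refine closure_minimal (fun x hx => ?_) hSc
      have hxΩ : x ∈ Ω := by
        by_contra h
        exact hx (indicator_of_notMem h _)
      refine ⟨subset_closure hxΩ, ?_⟩
      by_contra h
      refine hx ?_
      have h' : |(k + 1 : ℝ) * f x| ≤ 1 := (not_le.1 h).le
      rw [hφ, indicator_of_mem hxΩ, hη0 _ h', zero_div]
    have hφΩ : ∀ x ∈ Ω, φ =ᶠ[𝓝 x] fun x => η ((k + 1 : ℝ) * f x) / (k + 1) := fun x hx => by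
      filter_upwards [hΩ.isOpen.mem_nhds hx] with y hy
      rw [hφ, indicator_of_mem hy]
    have hφc : ContDiff ℝ 1 φ := by
      refine contDiff_iff_contDiffAt.2 fun x => ?_
      by_cases hx : x ∈ tsupport φ
      · have hxΩ := hSΩ (hsupp hx)
        refine ContDiffAt.congr_of_eventuallyEq ?_ (hφΩ x hxΩ)
        have hfx := hf.contDiffAt (mem_of_superset (hΩ.isOpen.mem_nhds hxΩ) subset_closure)
        exact (hη.contDiffAt.comp x (contDiffAt_const.mul hfx)).div_const _
      · exact (contDiffAt_const (c := (0 : ℝ))).congr_of_eventuallyEq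
          (notMem_tsupport_iff_eventuallyEq.1 hx)
    have key := hW φ hφc
      ((hΩb.isCompact_closure.inter_left hSc |>.of_isClosed_subset (isClosed_tsupport φ))
        fun x hx => ⟨hsupp hx, (hsupp hx).1⟩) (hsupp.trans hSΩ)
    rw [← key]
    refine setIntegral_congr_fun hΩm fun x hx => ?_
    have hd := (hf.differentiableAt_of_mem_open_closure hΩ.isOpen hx).hasFDerivAt
    have h1 : HasFDerivAt (fun x => η ((k + 1 : ℝ) * f x) / (k + 1))
        (deriv η ((k + 1 : ℝ) * f x) • fderiv ℝ f x) x := by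
      have h2 := ((hη.differentiable one_ne_zero _).hasDerivAt.comp_hasFDerivAt x
        (hd.const_mul (k + 1 : ℝ))).mul_const ((k + 1 : ℝ)⁻¹)
      convert! h2 using 1
      rw [smul_smul, smul_smul]
      congr 1
      field_simp
    simp only [hG, Finset.mul_sum]
    refine Finset.sum_congr rfl fun i _ => ?_
    rw [(hφΩ x hx).fderiv_eq, h1.fderiv, fderivWithin_closure_eq_fderiv hΩ.isOpen f hx]
    simp only [smul_apply, smul_eq_mul]
    ring
  have hGi : IntegrableOn G Ω := integrableOn_of_continuousOn_closure hΩb hGc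
  have hae : ∀ᵐ x ∂volume.restrict Ω, ∀ i, f x = 0 → fderiv ℝ f x (e i) = 0 := by
    rw [ae_all_iff]
    intro i
    rw [ae_restrict_iff' hΩm]
    exact ae_fderiv_apply_eq_zero_of_eq_zero hΩ.isOpen
      (fun x hx => (hf.differentiableAt_of_mem_open_closure hΩ.isOpen
        hx).differentiableWithinAt) (e i)
  -- Dominated convergence: the factor is eventually 1 where f ≠ 0, and where f = 0 the gradient of
  -- f, hence G, vanishes almost everywhere.
  have hlim : Tendsto (fun k : ℕ => ∫ x in Ω, deriv η ((k + 1 : ℝ) * f x) * G x) atTop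
      (𝓝 (∫ x in Ω, G x)) := by
    refine tendsto_integral_of_dominated_convergence (fun x => M * |G x|) (fun k => ?_)
      (hGi.abs.const_mul M) (fun k => ae_of_all _ fun x => ?_) ?_
    · exact ((hη'c.comp_continuousOn (continuousOn_const.mul hf.continuousOn)).mul
        hGc).mono subset_closure |>.aestronglyMeasurable hΩm
    · rw [norm_mul, Real.norm_eq_abs, Real.norm_eq_abs]
      gcongr
      exact hM _
    · filter_upwards [hae, ae_restrict_mem hΩm] with x hx hxΩ
      by_cases hfx : f x = 0
      · have : G x = 0 := Finset.sum_eq_zero fun i _ => by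
          rw [fderivWithin_closure_eq_fderiv hΩ.isOpen f hxΩ, hx i hfx, mul_zero]
        simp [this]
      · refine tendsto_const_nhds.congr' ?_
        have ht : Tendsto (fun k : ℕ => ((k : ℝ) + 1) * |f x|) atTop atTop :=
          (tendsto_natCast_atTop_atTop.atTop_add tendsto_const_nhds).atTop_mul_const
            (abs_pos.2 hfx)
        filter_upwards [ht.eventually_ge_atTop 2] with k hk
        rw [hη1 _ (by rw [abs_mul, abs_of_pos (by positivity : (0 : ℝ) < k + 1)]; exact hk),
          one_mul]
  simp_rw [hzero] at hlim
  exact (tendsto_nhds_unique tendsto_const_nhds hlim).symm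

end ZeroBoundaryValues

/-! ### Calculus of partial derivatives within a set -/

section PartialDerivatives

open Filter Topology Set

variable {n : ℕ}

/-- The `i`-th partial derivative of `f` within `s`. -/
noncomputable def partialWithin (s : Set (EuclideanSpace ℝ (Fin n)))
    (f : EuclideanSpace ℝ (Fin n) → ℝ) (i : Fin n) (x : EuclideanSpace ℝ (Fin n)) : ℝ :=
  fderivWithin ℝ f s x (EuclideanSpace.single i 1)

variable {s : Set (EuclideanSpace ℝ (Fin n))} {f g : EuclideanSpace ℝ (Fin n) → ℝ}

theorem contDiffOn_partialWithin {k m : WithTop ℕ∞} (hs : UniqueDiffOn ℝ s)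
    (hf : ContDiffOn ℝ m f s) (hk : k + 1 ≤ m) (i : Fin n) :
    ContDiffOn ℝ k (partialWithin s f i) s :=
  (hf.fderivWithin hs hk).clm_apply contDiffOn_const

theorem partialWithin_mul (hs : UniqueDiffOn ℝ s) (hf : ContDiffOn ℝ 1 f s)
    (hg : ContDiffOn ℝ 1 g s) (i : Fin n) {x : EuclideanSpace ℝ (Fin n)} (hx : x ∈ s) :
    partialWithin s (fun y => f y * g y) i x =
      f x * partialWithin s g i x + g x * partialWithin s f i x := by
  rw [partialWithin, fderivWithin_fun_mul (hs x hx) (hf.differentiableOn one_ne_zero x hx)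
    (hg.differentiableOn one_ne_zero x hx)]
  simp [partialWithin]

theorem partialWithin_add (hs : UniqueDiffOn ℝ s) (hf : ContDiffOn ℝ 1 f s)
    (hg : ContDiffOn ℝ 1 g s) (i : Fin n) {x : EuclideanSpace ℝ (Fin n)} (hx : x ∈ s) :
    partialWithin s (fun y => f y + g y) i x = partialWithin s f i x + partialWithin s g i x := by
  rw [partialWithin, fderivWithin_fun_add (hs x hx) (hf.differentiableOn one_ne_zero x hx)
    (hg.differentiableOn one_ne_zero x hx)]
  simp [partialWithin]

theorem partialWithin_sum {ι : Type*} [Fintype ι] {F : ι → EuclideanSpace ℝ (Fin n) → ℝ}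
    (hs : UniqueDiffOn ℝ s) (hF : ∀ j, ContDiffOn ℝ 1 (F j) s) (i : Fin n)
    {x : EuclideanSpace ℝ (Fin n)} (hx : x ∈ s) :
    partialWithin s (fun y => ∑ j, F j y) i x = ∑ j, partialWithin s (F j) i x := by
  rw [partialWithin, fderivWithin_fun_sum (hs x hx)
    fun j _ => (hF j).differentiableOn one_ne_zero x hx]
  simp [partialWithin]

theorem partialWithin_const_sub_sq (hs : UniqueDiffOn ℝ s) (hf : ContDiffOn ℝ 1 f s) (c : ℝ)
    (i : Fin n) {x : EuclideanSpace ℝ (Fin n)} (hx : x ∈ s) :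
    partialWithin s (fun y => c - f y * f y) i x = -(2 * f x * partialWithin s f i x) := by
  have h := partialWithin_mul hs hf hf i hx
  rw [partialWithin, fderivWithin_const_sub (hs x hx)]
  simp only [neg_apply]
  change -partialWithin s (fun y => f y * f y) i x = _
  rw [h]; ring

theorem partialWithin_coord_sub (hs : UniqueDiffOn ℝ s) (z : EuclideanSpace ℝ (Fin n))
    (i j : Fin n) {x : EuclideanSpace ℝ (Fin n)} (hx : x ∈ s) :
    partialWithin s (fun y => y j - z j) i x = if i = j then 1 else 0 := by
  have h : HasFDerivAt (fun y : EuclideanSpace ℝ (Fin n) => y j - z j)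
      (EuclideanSpace.proj j : EuclideanSpace ℝ (Fin n) →L[ℝ] ℝ) x :=
    (EuclideanSpace.proj j : EuclideanSpace ℝ (Fin n) →L[ℝ] ℝ).hasFDerivAt.sub_const _
  rw [partialWithin, h.hasFDerivWithinAt.fderivWithin (hs x hx)]
  simp [eq_comm]

theorem fderivWithin_apply_eq_sum_partialWithin (x w : EuclideanSpace ℝ (Fin n)) :
    fderivWithin ℝ f s x w = ∑ i, partialWithin s f i x * w i := by
  have h : w = ∑ i, w i • EuclideanSpace.single i (1 : ℝ) := by
    ext j
    simp [Finset.sum_apply, Pi.single_apply]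
  conv_lhs => rw [h]
  simp [partialWithin, mul_comm]

theorem iteratedFDerivWithin_two_eq_partialWithin (hs : UniqueDiffOn ℝ s)
    (hf : ContDiffOn ℝ 2 f s) (i j : Fin n) {x : EuclideanSpace ℝ (Fin n)} (hx : x ∈ s) :
    iteratedFDerivWithin ℝ 2 f s x
      ![EuclideanSpace.single i (1 : ℝ), EuclideanSpace.single j (1 : ℝ)] =
      partialWithin s (partialWithin s f j) i x := by
  have hd : DifferentiableWithinAt ℝ (fderivWithin ℝ f s) s x :=
    (hf.fderivWithin hs (m := 1) (by norm_num)).differentiableOn one_ne_zero x hx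
  rw [iteratedFDerivWithin_two_apply f hs hx]
  have h := (hd.hasFDerivWithinAt.clm_apply
    (hasFDerivWithinAt_const (EuclideanSpace.single j (1 : ℝ)) x s)).fderivWithin (hs x hx)
  unfold partialWithin
  rw [h]
  simp

theorem laplacianWithin_eq_sum_partialWithin (hs : UniqueDiffOn ℝ s)
    (hf : ContDiffOn ℝ 2 f s) {x : EuclideanSpace ℝ (Fin n)} (hx : x ∈ s) :
    laplacianWithin f s x = ∑ i, partialWithin s (partialWithin s f i) i x := by
  rw [laplacianWithin_eq_iteratedFDerivWithin_orthonormalBasis f hs hx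
    (EuclideanSpace.basisFun (Fin n) ℝ)]
  simp only [EuclideanSpace.basisFun_apply]
  exact Finset.sum_congr rfl fun i _ => iteratedFDerivWithin_two_eq_partialWithin hs hf i i hx

/-- Only interior points are needed; there the iterated derivatives within the closure are ordinary
ones and Schwarz's theorem applies. -/
theorem partialWithin_comm {Ω : Set (EuclideanSpace ℝ (Fin n))} (hΩ : IsC1Domain Ω)
    (hf : ContDiffOn ℝ 2 f (closure Ω)) (i j : Fin n) {x : EuclideanSpace ℝ (Fin n)}
    (hx : x ∈ Ω) :
    partialWithin (closure Ω) (partialWithin (closure Ω) f j) i x =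
      partialWithin (closure Ω) (partialWithin (closure Ω) f i) j x := by
  have hs := hΩ.uniqueDiffOn_closure
  have hnhds : closure Ω ∈ 𝓝 x := mem_of_superset (hΩ.isOpen.mem_nhds hx) subset_closure
  rw [← iteratedFDerivWithin_two_eq_partialWithin hs hf i j (subset_closure hx),
    ← iteratedFDerivWithin_two_eq_partialWithin hs hf j i (subset_closure hx),
    iteratedFDerivWithin_two_apply f hs (subset_closure hx),
    iteratedFDerivWithin_two_apply f hs (subset_closure hx)]
  have h1 : fderivWithin ℝ (fderivWithin ℝ f (closure Ω)) (closure Ω) x =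
      fderiv ℝ (fderiv ℝ f) x := by
    rw [fderivWithin_of_mem_nhds hnhds]
    refine Filter.EventuallyEq.fderiv_eq ?_
    filter_upwards [hΩ.isOpen.mem_nhds hx] with y hy
    exact fderivWithin_closure_eq_fderiv hΩ.isOpen f hy
  have h2 : IsSymmSndFDerivAt ℝ f x :=
    (hf.contDiffAt hnhds).isSymmSndFDerivAt (by simp)
  rw [h1]
  exact h2 _ _

end PartialDerivatives

/-! ### The integral identity for the gradient of a harmonic function -/

section IntegralIdentity

open Filter Topology Set

variable {n : ℕ} {Ω : Set (EuclideanSpace ℝ (Fin n))}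
  {ν : EuclideanSpace ℝ (Fin n) → EuclideanSpace ℝ (Fin n)}

theorem IsC1Domain.integral_divergence (hΩ : IsC1Domain Ω) (hΩb : Bornology.IsBounded Ω)
    (hν : ∀ x ∈ frontier Ω, IsUnitOuterNormal Ω x (ν x))
    {F : Fin n → EuclideanSpace ℝ (Fin n) → ℝ} (hF : ∀ i, ContDiffOn ℝ 1 (F i) (closure Ω)) :
    IntegrableOn (fun x => ∑ i, F i x * ν x i) (frontier Ω) μHE[n - 1] ∧
    ∫ x in Ω, ∑ i, partialWithin (closure Ω) (F i) i x =
      ∫ x in frontier Ω, ∑ i, F i x * ν x i ∂μHE[n - 1] := by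
  have h := fun i => hΩ.satisfiesDivergenceThm hΩb hν (hF i) (EuclideanSpace.single i (1 : ℝ))
  have hin : ∀ w : EuclideanSpace ℝ (Fin n), ∀ i,
      inner ℝ w (EuclideanSpace.single i (1 : ℝ)) = w i := fun w i => by
    simp [EuclideanSpace.inner_single_right]
  have hfin : Module.finrank ℝ (EuclideanSpace ℝ (Fin n)) - 1 = n - 1 := by simp
  have h1 := fun i => (h i).integrableOn_frontier
  have h2 := fun i => (h i).integral_eq
  simp only [hin, hfin] at h1 h2
  refine ⟨integrable_finsetSum _ fun i _ => h1 i, ?_⟩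
  rw [integral_finsetSum _ fun i _ => h1 i, integral_finsetSum _ fun i _ => ?_]
  · refine Finset.sum_congr rfl fun i _ => ?_
    rw [← h2 i]
    refine setIntegral_congr_fun hΩ.isOpen.measurableSet fun x hx => ?_
    simp only [partialWithin, fderivWithin_closure_eq_fderiv hΩ.isOpen _ hx]
  · exact integrableOn_of_continuousOn_closure hΩb
      (hΩ.continuousOn_fderivWithin_apply (hF i) _)

/-- The gradient of a partial derivative of a harmonic function is orthogonal to gradients of
functions with zero boundary values; here `p` plays the role of the gradient of the harmonic
function. -/
theorem IsC1Domain.integral_partialWithin_mul_partialWithin (hΩ : IsC1Domain Ω)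
    (hΩb : Bornology.IsBounded Ω) {p : Fin n → EuclideanSpace ℝ (Fin n) → ℝ}
    (hp : ∀ i, ContDiffOn ℝ 1 (p i) (closure Ω))
    (hdiv : ∀ x ∈ Ω, ∑ i, partialWithin (closure Ω) (p i) i x = 0)
    {f : EuclideanSpace ℝ (Fin n) → ℝ} (hf : ContDiffOn ℝ 1 f (closure Ω))
    (hf0 : ∀ x ∈ frontier Ω, f x = 0) (j : Fin n) :
    ∫ x in Ω, ∑ i, partialWithin (closure Ω) (p i) j x * partialWithin (closure Ω) f i x = 0 := by
  refine hΩ.setIntegral_sum_mul_fderivWithin_eq_zero hΩb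
    (e := fun i => EuclideanSpace.single i (1 : ℝ))
    (W := fun i => partialWithin (closure Ω) (p i) j)
    (fun i => hΩ.continuousOn_fderivWithin_apply (hp i) _) (fun φ hφ hφc hφΩ => ?_) hf hf0
  rw [← setIntegral_sum_fderiv_mul_fderiv_eq_zero (μ := volume) hΩ.isOpen
    (e := fun i => EuclideanSpace.single i (1 : ℝ)) (p := p)
    (fun i => (hp i).mono subset_closure) (fun x hx => ?_) hφ hφc hφΩ (EuclideanSpace.single j 1)]
  · refine setIntegral_congr_fun hΩ.isOpen.measurableSet fun x hx => ?_
    simp only [partialWithin, fderivWithin_closure_eq_fderiv hΩ.isOpen _ hx]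
  · rw [← hdiv x hx]
    simp only [partialWithin, fderivWithin_closure_eq_fderiv hΩ.isOpen _ hx]

/-- The data of the integral identity: `v = -Δu`, and `p` is the gradient of the harmonic function
`v + |x - z|² / (2n)`. -/
structure IsHarmonicGradientData (Ω : Set (EuclideanSpace ℝ (Fin n)))
    (ν : EuclideanSpace ℝ (Fin n) → EuclideanSpace ℝ (Fin n)) (u v : EuclideanSpace ℝ (Fin n) → ℝ)
    (p : Fin n → EuclideanSpace ℝ (Fin n) → ℝ) (z : EuclideanSpace ℝ (Fin n)) : Prop where
  domain : IsC1Domain Ω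
  bounded : Bornology.IsBounded Ω
  normal : ∀ x ∈ frontier Ω, IsUnitOuterNormal Ω x (ν x)
  contDiffOn_u : ContDiffOn ℝ 1 u (closure Ω)
  contDiffOn_partial : ∀ i, ContDiffOn ℝ 1 (partialWithin (closure Ω) u i) (closure Ω)
  contDiffOn_v : ContDiffOn ℝ 1 v (closure Ω)
  contDiffOn_p : ∀ i, ContDiffOn ℝ 1 (p i) (closure Ω)
  laplacian_u : ∀ x ∈ Ω,
    ∑ i, partialWithin (closure Ω) (partialWithin (closure Ω) u i) i x = -v x
  u_eq_zero : ∀ x ∈ frontier Ω, u x = 0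
  normal_derivative : ∀ x ∈ frontier Ω, ∑ i, partialWithin (closure Ω) u i x * ν x i = 0
  symm : ∀ x ∈ Ω, ∀ i j, partialWithin (closure Ω) (p i) j x = partialWithin (closure Ω) (p j) i x
  div_p : ∀ x ∈ Ω, ∑ i, partialWithin (closure Ω) (p i) i x = 0
  partial_v : ∀ x ∈ Ω, ∀ i, partialWithin (closure Ω) v i x = p i x - (x i - z i) / n

namespace IsHarmonicGradientData

variable {u v : EuclideanSpace ℝ (Fin n) → ℝ} {p : Fin n → EuclideanSpace ℝ (Fin n) → ℝ}
  {z : EuclideanSpace ℝ (Fin n)}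

theorem continuousOn_partialWithin (h : IsHarmonicGradientData Ω ν u v p z)
    {f : EuclideanSpace ℝ (Fin n) → ℝ} (hf : ContDiffOn ℝ 1 f (closure Ω)) (i : Fin n) :
    ContinuousOn (partialWithin (closure Ω) f i) (closure Ω) :=
  h.domain.continuousOn_fderivWithin_apply hf _

/-- Green's first identity with -Δu = v: the boundary term g ∂u/∂ν vanishes by the Neumann
condition, so g needs no boundary condition. -/
theorem integral_sum_partialWithin_mul_partialWithin (h : IsHarmonicGradientData Ω ν u v p z)
    {g : EuclideanSpace ℝ (Fin n) → ℝ} (hg : ContDiffOn ℝ 1 g (closure Ω)) :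
    ∫ x in Ω, ∑ i, partialWithin (closure Ω) g i x * partialWithin (closure Ω) u i x =
      ∫ x in Ω, g x * v x := by
  have hs := h.domain.uniqueDiffOn_closure
  have h1 := (h.domain.integral_divergence h.bounded h.normal
    (F := fun i x => g x * partialWithin (closure Ω) u i x)
    fun i => hg.mul (h.contDiffOn_partial i)).2
  have h2 : ∫ x in frontier Ω, ∑ i, g x * partialWithin (closure Ω) u i x * ν x i ∂μHE[n - 1]
      = 0 := by
    rw [setIntegral_congr_fun (g := fun _ => (0 : ℝ)) isClosed_frontier.measurableSet, integral_zero]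
    intro x hx
    simp only [mul_assoc]
    rw [← Finset.mul_sum, h.normal_derivative x hx, mul_zero]
  have hi1 : IntegrableOn (fun x => ∑ i, partialWithin (closure Ω) g i x *
      partialWithin (closure Ω) u i x) Ω :=
    integrableOn_of_continuousOn_closure h.bounded (continuousOn_finsetSum _ fun i _ =>
      (h.continuousOn_partialWithin hg i).mul (h.contDiffOn_partial i).continuousOn)
  have hi2 : IntegrableOn (fun x => g x * v x) Ω :=
    integrableOn_of_continuousOn_closure h.bounded (hg.continuousOn.mul h.contDiffOn_v.continuousOn)
  rw [h2, setIntegral_congr_fun (g := fun x => ∑ i, partialWithin (closure Ω) g i x *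
    partialWithin (closure Ω) u i x - g x * v x) h.domain.isOpen.measurableSet,
    integral_sub hi1 hi2] at h1
  · linarith
  · intro x hx
    simp only
    rw [sub_eq_add_neg, ← mul_neg, ← h.laplacian_u x hx, Finset.mul_sum, ← Finset.sum_add_distrib]
    refine Finset.sum_congr rfl fun i _ => ?_
    rw [partialWithin_mul hs hg (h.contDiffOn_partial i) i (subset_closure hx)]
    ring

/-- The integrand is the divergence of u p, because div p = 0, and u p vanishes on ∂Ω. -/
theorem integral_sum_mul_partialWithin (h : IsHarmonicGradientData Ω ν u v p z) :
    ∫ x in Ω, ∑ i, p i x * partialWithin (closure Ω) u i x = 0 := by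
  have hs := h.domain.uniqueDiffOn_closure
  have h1 := (h.domain.integral_divergence h.bounded h.normal
    (F := fun i x => u x * p i x) fun i => h.contDiffOn_u.mul (h.contDiffOn_p i)).2
  have h2 : ∫ x in frontier Ω, ∑ i, u x * p i x * ν x i ∂μHE[n - 1] = 0 := by
    rw [setIntegral_congr_fun (g := fun _ => (0 : ℝ)) isClosed_frontier.measurableSet, integral_zero]
    intro x hx
    simp [h.u_eq_zero x hx]
  rw [← h2, ← h1]
  refine setIntegral_congr_fun h.domain.isOpen.measurableSet fun x hx => ?_
  simp_rw [partialWithin_mul hs h.contDiffOn_u (h.contDiffOn_p _) _ (subset_closure hx)]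
  rw [Finset.sum_add_distrib, ← Finset.mul_sum, h.div_p x hx]
  simp

/-- Weak Bochner identity. Testing the weakly divergence-free field ∂ⱼp with u pⱼ and summing over j
gives, by symmetry of Dp, ∫ (u|Dp|² + ∇(|p|²/2)·∇u) = 0; Green's identity turns the second term into
∫ ½|p|² v. -/
theorem integral_mul_sum_sq (h : IsHarmonicGradientData Ω ν u v p z) :
    ∫ x in Ω, u x * ∑ i, ∑ j, partialWithin (closure Ω) (p j) i x ^ 2 =
      -∫ x in Ω, (∑ j, p j x * p j x) * (1 / 2) * v x := by
  have hs := h.domain.uniqueDiffOn_closure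
  have hpp : ContDiffOn ℝ 1 (fun x => (∑ j, p j x * p j x) * (1 / 2)) (closure Ω) :=
    (ContDiffOn.sum fun j _ => (h.contDiffOn_p j).mul (h.contDiffOn_p j)).mul contDiffOn_const
  have h1 := fun j => h.domain.integral_partialWithin_mul_partialWithin h.bounded h.contDiffOn_p
    h.div_p (f := fun x => u x * p j x) (h.contDiffOn_u.mul (h.contDiffOn_p j))
    (fun x hx => by rw [h.u_eq_zero x hx, zero_mul]) j
  rw [← h.integral_sum_partialWithin_mul_partialWithin hpp]
  have hi1 : IntegrableOn (fun x => u x * ∑ i, ∑ j, partialWithin (closure Ω) (p j) i x ^ 2) Ω :=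
    integrableOn_of_continuousOn_closure h.bounded (h.contDiffOn_u.continuousOn.mul
      (continuousOn_finsetSum _ fun i _ => continuousOn_finsetSum _ fun j _ =>
        (h.continuousOn_partialWithin (h.contDiffOn_p j) i).pow 2))
  have hi2 : IntegrableOn (fun x => ∑ i, partialWithin (closure Ω)
      (fun x => (∑ j, p j x * p j x) * (1 / 2)) i x * partialWithin (closure Ω) u i x) Ω :=
    integrableOn_of_continuousOn_closure h.bounded (continuousOn_finsetSum _ fun i _ =>
      (h.continuousOn_partialWithin hpp i).mul (h.contDiffOn_partial i).continuousOn)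
  rw [eq_neg_iff_add_eq_zero, ← integral_add hi1 hi2]
  have h2 : ∫ x in Ω, ∑ j, ∑ i, partialWithin (closure Ω) (p i) j x *
      partialWithin (closure Ω) (fun x => u x * p j x) i x = 0 := by
    rw [integral_finsetSum _ fun j _ => ?_]
    · exact Finset.sum_eq_zero fun j _ => h1 j
    · exact integrableOn_of_continuousOn_closure h.bounded (continuousOn_finsetSum _ fun i _ =>
        (h.continuousOn_partialWithin (h.contDiffOn_p i) j).mul
          (h.continuousOn_partialWithin (h.contDiffOn_u.mul (h.contDiffOn_p j)) i))
  rw [← h2]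
  refine setIntegral_congr_fun h.domain.isOpen.measurableSet fun x hx => ?_
  have hx' := subset_closure hx
  refine Eq.trans ?_ Finset.sum_comm
  rw [Finset.mul_sum, ← Finset.sum_add_distrib]
  refine Finset.sum_congr rfl fun i _ => ?_
  have h3 : partialWithin (closure Ω) (fun x => (∑ j, p j x * p j x) * (1 / 2)) i x =
      ∑ j, p j x * partialWithin (closure Ω) (p j) i x := by
    rw [partialWithin_mul hs (ContDiffOn.sum fun j _ => (h.contDiffOn_p j).mul (h.contDiffOn_p j))
      contDiffOn_const i hx', partialWithin_sum hs
      (fun j => (h.contDiffOn_p j).mul (h.contDiffOn_p j)) i hx']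
    simp_rw [partialWithin_mul hs (h.contDiffOn_p _) (h.contDiffOn_p _) i hx']
    simp only [partialWithin, fderivWithin_const_apply, zero_apply, mul_zero, zero_add,
      Finset.mul_sum]
    exact Finset.sum_congr rfl fun j _ => by ring
  rw [h3, Finset.mul_sum, Finset.sum_mul, ← Finset.sum_add_distrib]
  refine Finset.sum_congr rfl fun j _ => ?_
  rw [partialWithin_mul hs h.contDiffOn_u (h.contDiffOn_p j) i hx', h.symm x hx i j]
  ring

/-- Weak form of the fact that (x - z)·∇h is harmonic for harmonic h, hence orthogonal to Δu. The
test functions are (xⱼ - zⱼ)u, and the leftover term p·∇u has zero integral. -/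
theorem integral_radial_mul (h : IsHarmonicGradientData Ω ν u v p z) :
    ∫ x in Ω, (∑ j, (x j - z j) * p j x) * v x = 0 := by
  have hs := h.domain.uniqueDiffOn_closure
  have hX : ∀ j, ContDiffOn ℝ 1 (fun x : EuclideanSpace ℝ (Fin n) => x j - z j) (closure Ω) :=
    fun j => (((EuclideanSpace.proj j : EuclideanSpace ℝ (Fin n) →L[ℝ] ℝ).contDiff).sub
      contDiff_const).contDiffOn
  have hg : ContDiffOn ℝ 1 (fun x => ∑ j, (x j - z j) * p j x) (closure Ω) :=
    ContDiffOn.sum fun j _ => (hX j).mul (h.contDiffOn_p j)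
  have h1 := fun j => h.domain.integral_partialWithin_mul_partialWithin h.bounded h.contDiffOn_p
    h.div_p (f := fun x => (x j - z j) * u x) ((hX j).mul h.contDiffOn_u)
    (fun x hx => by rw [h.u_eq_zero x hx, mul_zero]) j
  have h2 : ∫ x in Ω, ∑ j, ∑ i, partialWithin (closure Ω) (p i) j x *
      partialWithin (closure Ω) (fun x => (x j - z j) * u x) i x = 0 := by
    rw [integral_finsetSum _ fun j _ => ?_]
    · exact Finset.sum_eq_zero fun j _ => h1 j
    · exact integrableOn_of_continuousOn_closure h.bounded (continuousOn_finsetSum _ fun i _ =>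
        (h.continuousOn_partialWithin (h.contDiffOn_p i) j).mul
          (h.continuousOn_partialWithin ((hX j).mul h.contDiffOn_u) i))
  have hi1 : IntegrableOn (fun x => ∑ j, ∑ i, partialWithin (closure Ω) (p i) j x *
      partialWithin (closure Ω) (fun x => (x j - z j) * u x) i x) Ω :=
    integrableOn_of_continuousOn_closure h.bounded (continuousOn_finsetSum _ fun j _ =>
      continuousOn_finsetSum _ fun i _ =>
        (h.continuousOn_partialWithin (h.contDiffOn_p i) j).mul
          (h.continuousOn_partialWithin ((hX j).mul h.contDiffOn_u) i))
  have hi2 : IntegrableOn (fun x => ∑ i, p i x * partialWithin (closure Ω) u i x) Ω :=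
    integrableOn_of_continuousOn_closure h.bounded (continuousOn_finsetSum _ fun i _ =>
      (h.contDiffOn_p i).continuousOn.mul (h.contDiffOn_partial i).continuousOn)
  rw [← h.integral_sum_partialWithin_mul_partialWithin hg]
  have h3 : ∫ x in Ω, ((∑ j, ∑ i, partialWithin (closure Ω) (p i) j x *
      partialWithin (closure Ω) (fun x => (x j - z j) * u x) i x) +
      ∑ i, p i x * partialWithin (closure Ω) u i x) = 0 := by
    rw [integral_add hi1 hi2, h2, h.integral_sum_mul_partialWithin, add_zero]
  rw [← h3]
  refine setIntegral_congr_fun h.domain.isOpen.measurableSet fun x hx => ?_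
  have hx' := subset_closure hx
  have h4 : ∑ j, ∑ i, partialWithin (closure Ω) (p i) j x *
      partialWithin (closure Ω) (fun x => (x j - z j) * u x) i x =
      ∑ i, ∑ j, (x j - z j) * partialWithin (closure Ω) (p j) i x *
        partialWithin (closure Ω) u i x := by
    -- The diagonal terms come from differentiating xⱼ - zⱼ; they sum to u div p = 0.
    have h5 : ∀ j i, partialWithin (closure Ω) (p i) j x *
        partialWithin (closure Ω) (fun x => (x j - z j) * u x) i x =
        (x j - z j) * partialWithin (closure Ω) (p j) i x * partialWithin (closure Ω) u i x +
        (if i = j then u x * partialWithin (closure Ω) (p i) i x else 0) := fun j i => by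
      rw [partialWithin_mul hs (hX j) h.contDiffOn_u i hx', partialWithin_coord_sub hs z i j hx',
        h.symm x hx i j]
      split_ifs with hij
      · subst hij; ring
      · ring
    simp_rw [h5]
    rw [Finset.sum_comm]
    simp_rw [Finset.sum_add_distrib]
    rw [add_eq_left]
    simp only [Finset.sum_ite_eq, Finset.mem_univ, if_true]
    rw [← Finset.mul_sum, h.div_p x hx, mul_zero]
  rw [h4, ← Finset.sum_add_distrib]
  refine Finset.sum_congr rfl fun i _ => ?_
  rw [partialWithin_sum hs (fun j => (hX j).mul (h.contDiffOn_p j)) i hx']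
  simp_rw [partialWithin_mul hs (hX _) (h.contDiffOn_p _) i hx', partialWithin_coord_sub hs z i _ hx']
  rw [Finset.sum_add_distrib, add_mul, Finset.sum_mul]
  simp

/-- Apply the divergence theorem to (c² - v²)p with ∇v = p - (x - z)/n. The constant c drops out of
the volume integral because div p = 0, and the radial term drops out by `integral_radial_mul`. -/
theorem integral_identity (h : IsHarmonicGradientData Ω ν u v p z) (c : ℝ) :
    IntegrableOn (fun x => (c ^ 2 - v x ^ 2) * ∑ i, p i x * ν x i) (frontier Ω) μHE[n - 1] ∧
    ∫ x in Ω, u x * ∑ i, ∑ j, partialWithin (closure Ω) (p j) i x ^ 2 =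
      1 / 4 * ∫ x in frontier Ω, (c ^ 2 - v x ^ 2) * ∑ i, p i x * ν x i ∂μHE[n - 1] := by
  have hs := h.domain.uniqueDiffOn_closure
  have hw : ContDiffOn ℝ 1 (fun x => c ^ 2 - v x * v x) (closure Ω) :=
    contDiffOn_const.sub (h.contDiffOn_v.mul h.contDiffOn_v)
  have h1 := h.domain.integral_divergence h.bounded h.normal
    (F := fun i x => (c ^ 2 - v x * v x) * p i x) fun i => hw.mul (h.contDiffOn_p i)
  have h2 : ∀ x, ∑ i, (c ^ 2 - v x * v x) * p i x * ν x i =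
      (c ^ 2 - v x ^ 2) * ∑ i, p i x * ν x i := fun x => by
    rw [Finset.mul_sum]
    exact Finset.sum_congr rfl fun i _ => by ring
  simp_rw [h2] at h1
  refine ⟨h1.1, ?_⟩
  rw [← h1.2, h.integral_mul_sum_sq]
  have hX : ContinuousOn (fun x => (∑ j, (x j - z j) * p j x) * v x) (closure Ω) :=
    (continuousOn_finsetSum _ fun j _ => ContinuousOn.mul (by fun_prop)
      (h.contDiffOn_p j).continuousOn).mul h.contDiffOn_v.continuousOn
  have hP : ContinuousOn (fun x => (∑ j, p j x * p j x) * (1 / 2) * v x) (closure Ω) :=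
    ((continuousOn_finsetSum _ fun j _ => (h.contDiffOn_p j).continuousOn.mul
      (h.contDiffOn_p j).continuousOn).mul continuousOn_const).mul h.contDiffOn_v.continuousOn
  have h3 : ∫ x in Ω, ∑ i, partialWithin (closure Ω)
      (fun x => (c ^ 2 - v x * v x) * p i x) i x =
      ∫ x in Ω, (-4 * ((∑ j, p j x * p j x) * (1 / 2) * v x) +
        2 / n * ((∑ j, (x j - z j) * p j x) * v x)) := by
    refine setIntegral_congr_fun h.domain.isOpen.measurableSet fun x hx => ?_
    have hx' := subset_closure hx
    simp only
    simp_rw [partialWithin_mul hs hw (h.contDiffOn_p _) _ hx',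
      partialWithin_const_sub_sq hs h.contDiffOn_v _ _ hx', h.partial_v x hx]
    rw [Finset.sum_add_distrib, ← Finset.mul_sum, h.div_p x hx, mul_zero, zero_add,
      Finset.sum_mul, Finset.sum_mul, Finset.sum_mul, Finset.mul_sum, Finset.mul_sum,
      ← Finset.sum_add_distrib]
    exact Finset.sum_congr rfl fun i _ => by ring
  rw [h3, integral_add ((integrableOn_of_continuousOn_closure h.bounded hP).const_mul _)
    ((integrableOn_of_continuousOn_closure h.bounded hX).const_mul _), integral_const_mul,
    integral_const_mul, h.integral_radial_mul]
  ring

end IsHarmonicGradientData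

end IntegralIdentity

/-! ### From the biharmonic problem to the harmonic gradient -/

section Biharmonic

open Filter Topology Set

variable {n : ℕ} {Ω : Set (EuclideanSpace ℝ (Fin n))}
  {ν : EuclideanSpace ℝ (Fin n) → EuclideanSpace ℝ (Fin n)} {u v : EuclideanSpace ℝ (Fin n) → ℝ}

theorem IsBiharmonicDirichletSolution.contDiffOn_neg_laplacianWithin
    (hu : IsBiharmonicDirichletSolution Ω ν u) (hΩ : IsC1Domain Ω)
    (hv : ∀ x, v x = -laplacianWithin u (closure Ω) x) : ContDiffOn ℝ 2 v (closure Ω) := by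
  have hs := hΩ.uniqueDiffOn_closure
  refine ContDiffOn.congr (f := fun x => -∑ i, partialWithin (closure Ω)
    (partialWithin (closure Ω) u i) i x) ?_ fun x hx => ?_
  · exact (ContDiffOn.sum fun i _ => contDiffOn_partialWithin hs
      -- Order count 4 → 3 → 2: v keeps just two derivatives up to the boundary.
      (contDiffOn_partialWithin (k := 3) hs hu.contDiffOn (by norm_num) i) (by norm_num) i).neg
  · rw [hv, laplacianWithin_eq_sum_partialWithin hs (hu.contDiffOn.of_le (by norm_num)) hx]

theorem IsBiharmonicDirichletSolution.laplacianWithin_eq_neg_one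
    (hu : IsBiharmonicDirichletSolution Ω ν u) (hΩ : IsC1Domain Ω)
    (hv : ∀ x, v x = -laplacianWithin u (closure Ω) x) {x : EuclideanSpace ℝ (Fin n)}
    (hx : x ∈ Ω) : laplacianWithin v (closure Ω) x = -1 := by
  have h : v = -laplacianWithin u (closure Ω) := funext hv
  rw [h, laplacianWithin_neg hΩ.uniqueDiffOn_closure (subset_closure hx)]
  simp [hu.equation x hx]

/-- The components of the gradient of `v + |x - z|² / (2n)`. -/
noncomputable def shiftedGradient (Ω : Set (EuclideanSpace ℝ (Fin n)))
    (v : EuclideanSpace ℝ (Fin n) → ℝ) (z : EuclideanSpace ℝ (Fin n)) (i : Fin n)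
    (x : EuclideanSpace ℝ (Fin n)) : ℝ :=
  partialWithin (closure Ω) v i x + (1 / n : ℝ) * (x i - z i)

theorem contDiffOn_mul_coord_sub {s : Set (EuclideanSpace ℝ (Fin n))} (c : ℝ)
    (z : EuclideanSpace ℝ (Fin n)) (i : Fin n) :
    ContDiffOn ℝ 1 (fun x : EuclideanSpace ℝ (Fin n) => c * (x i - z i)) s :=
  (contDiff_const.mul ((EuclideanSpace.proj i : EuclideanSpace ℝ (Fin n) →L[ℝ] ℝ).contDiff.sub
    contDiff_const)).contDiffOn

theorem partialWithin_shiftedGradient (hΩ : IsC1Domain Ω) (hv : ContDiffOn ℝ 2 v (closure Ω))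
    (z : EuclideanSpace ℝ (Fin n)) (i j : Fin n) {x : EuclideanSpace ℝ (Fin n)}
    (hx : x ∈ closure Ω) :
    partialWithin (closure Ω) (shiftedGradient Ω v z j) i x =
      partialWithin (closure Ω) (partialWithin (closure Ω) v j) i x +
        if i = j then (1 / n : ℝ) else 0 := by
  have hs := hΩ.uniqueDiffOn_closure
  unfold shiftedGradient
  have h1 : ContDiffOn ℝ 1 (fun x : EuclideanSpace ℝ (Fin n) => x j - z j) (closure Ω) := by
    simpa using contDiffOn_mul_coord_sub 1 z j
  rw [partialWithin_add hs (contDiffOn_partialWithin hs hv (by norm_num) j)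
    (contDiffOn_mul_coord_sub _ z j) i hx, partialWithin_mul hs contDiffOn_const h1 i hx,
    partialWithin_coord_sub hs z i j hx]
  simp [partialWithin]

theorem IsBiharmonicDirichletSolution.isHarmonicGradientData
    (hu : IsBiharmonicDirichletSolution Ω ν u) (hn : n ≠ 0) (hΩ : IsC1Domain Ω)
    (hΩb : Bornology.IsBounded Ω) (hν : ∀ x ∈ frontier Ω, IsUnitOuterNormal Ω x (ν x))
    (hv : ∀ x, v x = -laplacianWithin u (closure Ω) x) (z : EuclideanSpace ℝ (Fin n)) :
    IsHarmonicGradientData Ω ν u v (shiftedGradient Ω v z) z := by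
  have hs := hΩ.uniqueDiffOn_closure
  have hv2 := hu.contDiffOn_neg_laplacianWithin hΩ hv
  have hu2 : ContDiffOn ℝ 2 u (closure Ω) := hu.contDiffOn.of_le (by norm_num)
  exact
    { domain := hΩ
      bounded := hΩb
      normal := hν
      contDiffOn_u := hu.contDiffOn.of_le (by norm_num)
      contDiffOn_partial := fun i => contDiffOn_partialWithin hs hu2 (by norm_num) i
      contDiffOn_v := hv2.of_le (by norm_num)
      contDiffOn_p := fun i => (contDiffOn_partialWithin hs hv2 (by norm_num) i).add
        (contDiffOn_mul_coord_sub _ z i)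
      laplacian_u := fun x hx => by
        rw [hv, neg_neg, laplacianWithin_eq_sum_partialWithin hs hu2 (subset_closure hx)]
      u_eq_zero := hu.boundary_value
      normal_derivative := fun x hx => by
        rw [← fderivWithin_apply_eq_sum_partialWithin, hu.normal_derivative x hx]
      symm := fun x hx i j => by
        rw [partialWithin_shiftedGradient hΩ hv2 z j i (subset_closure hx),
          partialWithin_shiftedGradient hΩ hv2 z i j (subset_closure hx),
          partialWithin_comm hΩ hv2 i j hx]
        simp only [eq_comm]
      div_p := fun x hx => by
        simp_rw [partialWithin_shiftedGradient hΩ hv2 z _ _ (subset_closure hx)]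
        rw [Finset.sum_add_distrib, ← laplacianWithin_eq_sum_partialWithin hs hv2
          (subset_closure hx), hu.laplacianWithin_eq_neg_one hΩ hv hx]
        simp [hn]
      partial_v := fun x _ i => by
        rw [shiftedGradient]; ring }

/-- Expanding |D²v + I/n|² gives |D²v|² + (2/n)Δv + 1/n, which equals |D²v|² - 1/n because Δv = -1.
-/
theorem IsBiharmonicDirichletSolution.hessianNormSqWithin_sub_eq
    (hu : IsBiharmonicDirichletSolution Ω ν u) (hn : n ≠ 0) (hΩ : IsC1Domain Ω)
    (hv : ∀ x, v x = -laplacianWithin u (closure Ω) x) (z : EuclideanSpace ℝ (Fin n))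
    {x : EuclideanSpace ℝ (Fin n)} (hx : x ∈ Ω) :
    hessianNormSqWithin v (closure Ω) x - laplacianWithin v (closure Ω) x ^ 2 / n =
      ∑ i, ∑ j, partialWithin (closure Ω) (shiftedGradient Ω v z j) i x ^ 2 := by
  have hs := hΩ.uniqueDiffOn_closure
  have hv2 := hu.contDiffOn_neg_laplacianWithin hΩ hv
  have hx' := subset_closure hx
  have hlap := hu.laplacianWithin_eq_neg_one hΩ hv hx
  have hlap' := laplacianWithin_eq_sum_partialWithin hs hv2 hx'
  have hn' : (n : ℝ) ≠ 0 := Nat.cast_ne_zero.2 hn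
  simp_rw [hessianNormSqWithin, iteratedFDerivWithin_two_eq_partialWithin hs hv2 _ _ hx',
    partialWithin_shiftedGradient hΩ hv2 z _ _ hx']
  have h1 : ∀ i j : Fin n, (partialWithin (closure Ω) (partialWithin (closure Ω) v j) i x +
      if i = j then (1 / n : ℝ) else 0) ^ 2 =
      partialWithin (closure Ω) (partialWithin (closure Ω) v j) i x ^ 2 +
      if i = j then 2 / n * partialWithin (closure Ω) (partialWithin (closure Ω) v i) i x +
        (1 / n : ℝ) ^ 2 else 0 := fun i j => by
    split_ifs with h
    · subst h; ring
    · ring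
  simp_rw [h1, Finset.sum_add_distrib]
  simp only [Finset.sum_ite_eq, Finset.mem_univ, if_true]
  rw [Finset.sum_add_distrib, ← Finset.mul_sum, ← hlap', hlap]
  simp only [Finset.sum_const, Finset.card_univ, Fintype.card_fin, nsmul_eq_mul]
  field_simp
  ring

end Biharmonic

theorem mainTheorem2 (n : ℕ) (hn : 2 ≤ n) (Ω : Set (EuclideanSpace ℝ (Fin n)))
    (hΩ : IsC1Domain Ω) (hΩb : Bornology.IsBounded Ω)
    (ν : EuclideanSpace ℝ (Fin n) → EuclideanSpace ℝ (Fin n))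
    (hν : ∀ x ∈ frontier Ω, IsUnitOuterNormal Ω x (ν x))
    (u : EuclideanSpace ℝ (Fin n) → ℝ) (hu : IsBiharmonicDirichletSolution Ω ν u)
    (v : EuclideanSpace ℝ (Fin n) → ℝ) (hv : ∀ x, v x = -laplacianWithin u (closure Ω) x)
    (z : EuclideanSpace ℝ (Fin n)) (hz : z ∈ Ω) (c : ℝ) :
    IntegrableOn (fun x => u x *
        (hessianNormSqWithin v (closure Ω) x - (laplacianWithin v (closure Ω) x) ^ 2 / n))
      Ω volume ∧
    IntegrableOn (fun x => (c ^ 2 - (laplacianWithin u (closure Ω) x) ^ 2) *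
        (fderivWithin ℝ v (closure Ω) x (ν x) + inner ℝ (x - z) (ν x) / n))
      (frontier Ω) μHE[n - 1] ∧
    (∫ x in Ω, u x *
        (hessianNormSqWithin v (closure Ω) x - (laplacianWithin v (closure Ω) x) ^ 2 / n)) =
      1 / 4 * ∫ x in frontier Ω, (c ^ 2 - (laplacianWithin u (closure Ω) x) ^ 2) *
        (fderivWithin ℝ v (closure Ω) x (ν x) + inner ℝ (x - z) (ν x) / n) ∂μHE[n - 1] := by
  have hn0 : n ≠ 0 := by omega
  have h := hu.isHarmonicGradientData hn0 hΩ hΩb hν hv z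
  -- The boundary integrand is the normal flux of (c² - v²)p, as (Δu)² = v² and the second factor is
  -- p·ν.
  have hbd : ∀ x, (c ^ 2 - (laplacianWithin u (closure Ω) x) ^ 2) *
      (fderivWithin ℝ v (closure Ω) x (ν x) + inner ℝ (x - z) (ν x) / n) =
      (c ^ 2 - v x ^ 2) * ∑ i, shiftedGradient Ω v z i x * ν x i := fun x => by
    rw [hv x, neg_sq, fderivWithin_apply_eq_sum_partialWithin, PiLp.inner_apply, Finset.sum_div,
      ← Finset.sum_add_distrib]
    congr 1
    refine Finset.sum_congr rfl fun i _ => ?_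
    simp only [shiftedGradient, PiLp.sub_apply, RCLike.inner_apply, conj_trivial]
    ring
  have hint : Set.EqOn (fun x => u x *
      (hessianNormSqWithin v (closure Ω) x - (laplacianWithin v (closure Ω) x) ^ 2 / n))
      (fun x => u x * ∑ i, ∑ j,
        partialWithin (closure Ω) (shiftedGradient Ω v z j) i x ^ 2) Ω := fun x hx => by
    simp only
    rw [hu.hessianNormSqWithin_sub_eq hn0 hΩ hv z hx]
  have hid := h.integral_identity c
  simp_rw [hbd]
  refine ⟨?_, hid.1, ?_⟩
  · rw [integrableOn_congr_fun hint hΩ.isOpen.measurableSet]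
    exact integrableOn_of_continuousOn_closure hΩb (h.contDiffOn_u.continuousOn.mul
      (continuousOn_finsetSum _ fun i _ => continuousOn_finsetSum _ fun j _ =>
        (h.continuousOn_partialWithin (h.contDiffOn_p j) i).pow 2))
  · rw [setIntegral_congr_fun hΩ.isOpen.measurableSet hint, hid.2]
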